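/- **Setting.** For $x=(x_1,\dots,x_n)$, $m=(m_1,\dots,m_n)$ put $$u_{x,m}(\xi)=\tfrac12\sum_{j=1}^n m_j e^{-2|\xi-x_j|}.$$ If $x_1<\dots<x_n$, let $y_0=-1$, $y_j=\tanh x_j$ $(1\le j\le n)$, $y_{n+1}=1$, $g_j=m_j/(1-y_j^2)$, and let $\varphi(y,z)$ be the continuous, piecewise linear solution on $[-1,1]$ of $$\varphi''=z\Big(\sum_{j=1}^n g_j\delta_{y_j}\Big)\varphi,\qquad \varphi(-1,z)=0,\quad \varphi'(-1,z)=1 .$$ We say that $(x,m)$ has scattering data $\{\lambda_j,a_j\}_{j=1}^n$ if the zeros of $\varphi(1,z)$ are exactly $\lambda_1,\dots,\lambda_n$ and $$\frac{\varphi'(1-,z)}{z\,\varphi(1,z)}=\frac1{2z}+\sum_{j=1}^n\frac{a_j}{z-\lambda_j}.$$ Let $\lambda_1,\dots,\lambda_n$ be distinct non-zero real numbers, let $a_1(0),\dots,a_n(0)>0$, and put $a_j(t)=a_j(0)e^{-2t/\lambda_j}$. With $\lambda_0=0$ and $a_0(t)=\frac12$ let $$A_k(t)=\sum_{j=0}^n(-\lambda_j)^k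 a_j(t),\qquad \Delta^1_k(t)=\det\big(A_{1+i+j}(t)\big)_{0\le i,j\le k-1},\qquad \Delta^1_0=1 .$$ Call $t$ regular if $\Delta^1_k(t)\neq0$ for $0\le k\le n$. The multipeakon solution of the Camassa–Holm equation with these data is a pair $(x(t),m(t))$ such that at every regular time $t$ one has $x_1<\dots<x_n$, $m_j\ne0$ and $$\dot x_j=u(x_j,t),\qquad \dot m_j=-\langle u_x(x_j,t)\rangle\, m_j ,\qquad u(\cdot,t)=u_{x(t),m(t)},$$ ($\langle\cdot\rangle$ is the average of the left and right limits), and such that on every interval of regular times, $(x(s),m(s))$ has scattering data $\{\lambda_j,a_j(s)\}$ at some time $s$ in that interval. (The solution is thus continued through the singular times by means of its scattering data.) The term with index $j$ is a peakon with peak at $x_j$ if $m_j>0$, and an antipeakon with trough at $x_j$ if $m_j<0$. **Theorem 6.1.** Suppose that $\Delta^1_{n-k}(t_0)=0$ for at least one $k\in\{0,\dots,n\}$, and let $K$ be the set of all such $k$. Then: 1. All times $t\neq t_0$ sufficiently close to $t_0$ are regular. $K\subset\{1,\dots,n-1\}$ and $K$ contains no two consecutive integers, so that the pairs $\{k,k+1\}$,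 $k\in K$, are pairwise disjoint. 2. As $t\to t_0$ every $x_j(t)$ converges to a finite limit $x_j(t_0)$, with $x_1(t_0)\le\dots\le x_n(t_0)$; for $i<j$ one has $x_i(t_0)=x_j(t_0)$ if and only if $j=i+1$ and $i\in K$. Thus collisions occur exactly within the distinct pairs $(x_k,x_{k+1})$, $k\in K$. 3. For each $k\in K$: for $t<t_0$ close to $t_0$ one has $m_k(t)>0>m_{k+1}(t)$ (peak at $x_k$, trough at $x_{k+1}$), and for $t>t_0$ close to $t_0$ one has $m_k(t)<0<m_{k+1}(t)$ (trough at $x_k$, peak at $x_{k+1}$). 4. There are real numbers $m_1(t_0),\dots,m_n(t_0)$ such that, as $t\to t_0$ from either side, $u(\xi,t)$ converges uniformly in $\xi\in\mathbb R$ to $$\tfrac12\sum_{j=1}^n m_j(t_0)e^{-2|\xi-x_j(t_0)|}.$$ -/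

import Mathlib

open Filter Topology

namespace Peakon

noncomputable section

/-! Positions and weights are sequences `x m : ℕ → ℝ` of which only the entries with
index `1, …, n` are used, so that the numbering is the usual one. -/

/-- The multipeakon profile `u(ξ) = (1/2) ∑_{j=1}^n m_j exp(-2|ξ - x_j|)`. -/
def profile (n : ℕ) (x m : ℕ → ℝ) (ξ : ℝ) : ℝ :=
  (1 / 2) * ∑ j ∈ Finset.Icc 1 n, m j * Real.exp (-2 * |ξ - x j|)

/-- The derivative `u_x(ξ)` of the profile; at a point where `u_x` jumps, the value is the
average of the left and right limits (since `Real.sign 0 = 0`). -/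
def profileSlope (n : ℕ) (x m : ℕ → ℝ) (ξ : ℝ) : ℝ :=
  -∑ j ∈ Finset.Icc 1 n, m j * Real.sign (ξ - x j) * Real.exp (-2 * |ξ - x j|)

/-! ### The discrete string and its scattering data -/

/-- The points `y_0 = -1`, `y_j = tanh x_j` for `1 ≤ j ≤ n`, `y_{n+1} = 1`. -/
def stringY (n : ℕ) (x : ℕ → ℝ) (j : ℕ) : ℝ :=
  if j = 0 then -1 else if j ≤ n then Real.tanh (x j) else 1

/-- The lengths `l_j = y_{j+1} - y_j`. -/
def stringL (n : ℕ) (x : ℕ → ℝ) (j : ℕ) : ℝ :=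
  stringY n x (j + 1) - stringY n x j

/-- The masses `g_j` of the string, `m_j = g_j (1 - y_j ^ 2)`. -/
def stringG (n : ℕ) (x m : ℕ → ℝ) (j : ℕ) : ℝ :=
  m j / (1 - stringY n x j ^ 2)

/-- The piecewise linear solution of `φ'' = z g φ`, `φ(-1) = 0`, `φ'(-1) = 1`: the pair at
index `j` consists of the value `φ(y_j)` and of the slope of `φ` on `(y_j, y_{j+1})`. -/
def wave (n : ℕ) (x m : ℕ → ℝ) (z : ℝ) : ℕ → ℝ × ℝ
  | 0 => (0, 1)
  | j + 1 =>
    ((wave n x m z j).1 + stringL n x j * (wave n x m z j).2,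
      (wave n x m z j).2 + z * stringG n x m (j + 1) *
        ((wave n x m z j).1 + stringL n x j * (wave n x m z j).2))

/-- `φ(1, z)`. -/
def waveEnd (n : ℕ) (x m : ℕ → ℝ) (z : ℝ) : ℝ := (wave n x m z (n + 1)).1

/-- `D₋φ(1, z)`, the slope of `φ` on the last interval `(y_n, 1)`. -/
def waveEndSlope (n : ℕ) (x m : ℕ → ℝ) (z : ℝ) : ℝ := (wave n x m z n).2

/-- The Weyl function `w(z) = D₋φ(1, z) / φ(1, z)`. -/
def weyl (n : ℕ) (x m : ℕ → ℝ) (z : ℝ) : ℝ := waveEndSlope n x m z / waveEnd n x m z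

/-- The string attached to `(x, m)` has spectrum `{lam j}` and residues `a j`: the `lam j` are
the zeros of `φ(1, z)` and `w(z)/z = 1/(2z) + ∑ j, a j / (z - lam j)`. -/
def HasScatteringData (n : ℕ) (x m : ℕ → ℝ) (lam a : Fin n → ℝ) : Prop :=
  (∀ z : ℝ, waveEnd n x m z = 0 ↔ ∃ j, lam j = z) ∧
    ∀ z : ℝ, z ≠ 0 → (∀ j, lam j ≠ z) →
      weyl n x m z / z = 1 / (2 * z) + ∑ j, a j / (z - lam j)

/-! ### Moments and Hankel determinants -/

/-- The residues at time `t`: `a_j(t) = a_j(0) exp(-2t/lam_j)`. -/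
def residue {n : ℕ} (lam a : Fin n → ℝ) (t : ℝ) (j : Fin n) : ℝ :=
  a j * Real.exp (-2 * t / lam j)

/-- The moments `A_k = ∑_{j=0}^n (-lam_j)^k a_j`, where `lam_0 = 0` and `a_0 = 1/2`. -/
def moment {n : ℕ} (lam a : Fin n → ℝ) (k : ℕ) : ℝ :=
  (1 / 2) * 0 ^ k + ∑ j, (-lam j) ^ k * a j

/-- The Hankel determinant `Δ^l_k`, of size `k`, with entries `A_{l+i+j}`, `0 ≤ i, j < k`. -/
def hankel {n : ℕ} (lam a : Fin n → ℝ) (l k : ℕ) : ℝ :=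
  (Matrix.of fun i j : Fin k => moment lam a (l + i + j)).det

/-- `Δ^1_k` at time `t`. -/
def hankelOne {n : ℕ} (lam a : Fin n → ℝ) (k : ℕ) (t : ℝ) : ℝ :=
  hankel lam (residue lam a t) 1 k

/-- The time `t` is regular if none of `Δ^1_0(t), …, Δ^1_n(t)` vanishes. -/
def IsRegularTime {n : ℕ} (lam a : Fin n → ℝ) (t : ℝ) : Prop :=
  ∀ k ≤ n, hankelOne lam a k t ≠ 0

/-! ### Multipeakon solutions -/

/-- `(x, m)` is the multipeakon solution of the Camassa–Holm equation, continued through the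
singular times, with spectrum `lam j` and residues `a j` at time zero. At regular times it is
a solution of the Hamiltonian system `x_j' = u(x_j)`, `m_j' = -⟨u_x(x_j)⟩ m_j`; which solution
it is on a given interval of regular times is fixed by prescribing the scattering data at one
time `s` of that interval. Nothing is required at singular times. -/
structure IsMultipeakon (n : ℕ) (lam a : Fin n → ℝ) (x m : ℝ → ℕ → ℝ) : Prop where
  ordered : ∀ t, IsRegularTime lam a t → StrictMonoOn (x t) (Set.Icc 1 n)
  weight_ne_zero : ∀ t, IsRegularTime lam a t → ∀ j ∈ Set.Icc 1 n, m t j ≠ 0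
  hasDerivAt_position : ∀ t, IsRegularTime lam a t → ∀ j ∈ Set.Icc 1 n,
    HasDerivAt (fun s => x s j) (profile n (x t) (m t) (x t j)) t
  hasDerivAt_weight : ∀ t, IsRegularTime lam a t → ∀ j ∈ Set.Icc 1 n,
    HasDerivAt (fun s => m s j) (-profileSlope n (x t) (m t) (x t j) * m t j) t
  scattering : ∀ t, IsRegularTime lam a t → ∃ s, (∀ r ∈ Set.uIcc s t, IsRegularTime lam a r) ∧
    HasScatteringData n (x s) (m s) lam (residue lam a s)

end

end Peakon

/-! ### Minors of the adjugate and derivatives of determinants -/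

namespace Matrix

variable {ι R : Type*} [DecidableEq ι] [Fintype ι] [CommRing R]

/-! The scattering data linearise the flow: along a solution the eigenvalues stay fixed and the
residues are multiplied by exponentials (`IsMultipeakon.isSpectralData`). Stieltjes' solution of the
inverse problem for a discrete string (`string_eq_hankelDet`) then makes positions and weights
explicit. Let T^l_k be the Hankel determinants without the atom at 0, and D_k the determinant Δ^0_k
with it; for l ≥ 1 the atom plays no role, so T^1_k = Δ^1_k. With j = n - k, 1 - tanh x_j = T^2_k /
D_{k+1} and m_j = 2 T^0_{k+1} T^2_k / (Δ^1_{k+1} Δ^1_k).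

Up to size n, T^0, T^2 and D are positive, being Hankel determinants of positive measures. Hence the
positions extend differentiably to every time, and a weight can blow up only where some Δ^1
vanishes. By the Desnanot–Jacobi identity, tanh x_{j+1} - tanh x_j is (Δ^1_{n-j})^2 divided by a
positive quantity, so neighbours meet exactly when Δ^1_{n-j} = 0.

The core is `tailHankel_one_neighbours`: if Δ^1_{k+1} = 0, determinant identities force Δ^1_k and
Δ^1_{k+2} to be nonzero with opposite signs, and the zero in t to be simple, with derivative of the
sign of Δ^1_k. This isolates the singular times, makes the colliding pairs disjoint and exchanges
the signs of the two weights. The singular parts of these weights cancel, so their sum converges;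
the gap vanishes together with its derivative, so weight times gap tends to 0. Each pair therefore
merges into a single term of the limit profile (`tendstoUniformly_profile`). -/

/-- The matrix is a rank-two perturbation 1 + UV of the identity, and det (1 + UV) = det (1 + VU)
leaves a 2 × 2 determinant. -/
theorem det_one_updateCol_updateCol {r s : ι} (hrs : r ≠ s) (u v : ι → R) :
    (((1 : Matrix ι ι R).updateCol r u).updateCol s v).det = u r * v s - u s * v r := by
  have key : ((1 : Matrix ι ι R).updateCol r u).updateCol s v =
      1 + (of fun i (c : Fin 2) => if c = 0 then u i - (Pi.single r 1 : ι → R) i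
          else v i - (Pi.single s 1 : ι → R) i : Matrix ι (Fin 2) R) *
        (of fun (c : Fin 2) i => if c = 0 then (Pi.single r 1 : ι → R) i
          else (Pi.single s 1 : ι → R) i : Matrix (Fin 2) ι R) := by
    ext i j
    simp only [updateCol_apply, add_apply, mul_apply, Fin.sum_univ_two, of_apply, one_apply,
      Pi.single_apply]
    by_cases hs : j = s
    · subst hs; simp [hrs.symm]
    · by_cases hr : j = r
      · subst hr; simp [hs]
      · simp [hs, hr]
  rw [key, det_one_add_mul_comm, det_fin_two]
  simp [mul_apply, Pi.single_apply, hrs, hrs.symm]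
  ring

/-- Jacobi's identity for 2 × 2 minors of the adjugate. Multiplying `A` by the identity with two
columns replaced by columns of `adjugate A` gives `A` with two columns replaced by multiples `A.det`
of unit vectors; comparing determinants gives the claim times `A.det`. -/
theorem adjugate_mul_adjugate_sub (A : Matrix ι ι R) {r s : ι} (hrs : r ≠ s) (p q : ι) :
    adjugate A r p * adjugate A s q - adjugate A s p * adjugate A r q =
      A.det * ((A.updateCol r (Pi.single p 1)).updateCol s (Pi.single q 1)).det := by
  have aux : ∀ {S : Type _} [CommRing S] (A : Matrix ι ι S),
      A.det * (adjugate A r p * adjugate A s q - adjugate A s p * adjugate A r q) =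
      A.det * (A.det * ((A.updateCol r (Pi.single p 1)).updateCol s (Pi.single q 1)).det) := by
    intro S _ A
    rw [← det_one_updateCol_updateCol hrs (fun i => adjugate A i p) (fun i => adjugate A i q),
      ← det_mul]
    have h : A * ((1 : Matrix ι ι S).updateCol r fun i => adjugate A i p).updateCol s
        (fun i => adjugate A i q) =
        (A.updateCol r (A.det • Pi.single p 1)).updateCol s (A.det • Pi.single q 1) := by
      ext i j
      have hm : ∀ k, ∑ l, A i l * adjugate A l k = A.det * (1 : Matrix ι ι S) i k := by
        intro k
        have := congrFun (congrFun (mul_adjugate A) i) k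
        simpa [mul_apply] using this
      by_cases hs : j = s
      · subst hs
        simp [mul_apply, hm, one_apply, Pi.single_apply]
      · by_cases hr : j = r
        · subst hr
          simp [mul_apply, hm, one_apply, Pi.single_apply, hs]
        · simp [mul_apply, one_apply, hs, hr]
    rw [h, det_updateCol_smul, updateCol_comm _ hrs, det_updateCol_smul, updateCol_comm _ hrs.symm]
  -- The factor `A.det` may be a zero divisor in `R`, so it is cancelled for the generic matrix over
  -- ℤ, and the result is specialised.
  let X := mvPolynomialX ι ι ℤ
  have hX := mul_left_cancel₀ (det_mvPolynomialX_ne_zero ι ℤ) (aux X)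
  let f := MvPolynomial.aeval (R := ℤ) (fun ij : ι × ι => A ij.1 ij.2)
  have hf : f.mapMatrix X = A := mvPolynomialX_mapMatrix_aeval ℤ A
  have := congrArg f hX
  rw [← hf, ← AlgHom.map_adjugate, ← AlgHom.map_det]
  simp only [map_sub, map_mul] at this
  rw [AlgHom.mapMatrix_apply, AlgHom.mapMatrix_apply]
  simp only [map_apply]
  rw [this, AlgHom.map_det f ((X.updateCol r _).updateCol s _)]
  congr 2
  ext i j
  simp [updateCol_apply, Pi.single_apply, apply_ite f]

/-- Replacing column `s` by a unit vector and column `0` by the first unit vector gives, up to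
sign, a determinant of size smaller by two. -/
theorem det_updateCol_zero_updateCol_succ {k : ℕ} (A : Matrix (Fin (k + 2)) (Fin (k + 2)) R)
    (s q : Fin (k + 1)) :
    ((A.updateCol 0 (Pi.single 0 1)).updateCol s.succ (Pi.single q.succ 1)).det =
      (-1) ^ (q + s : ℕ) * (A.submatrix (fun i => (q.succAbove i).succ)
        (fun j => (s.succAbove j).succ)).det := by
  rw [det_succ_column _ s.succ, Finset.sum_eq_single q.succ]
  · have h : (((A.updateCol 0 (Pi.single 0 1)).updateCol s.succ
        (Pi.single q.succ 1)).submatrix q.succ.succAbove s.succ.succAbove) =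
        ((A.updateCol 0 (Pi.single 0 1)).submatrix q.succ.succAbove s.succ.succAbove) := by
      ext i j
      simp [updateCol_apply, Fin.succAbove_ne]
    rw [h, det_succ_column_zero, Finset.sum_eq_single 0]
    · simp only [updateCol_self, Pi.single_eq_same, submatrix_apply, submatrix_submatrix]
      simp [pow_add]
      have h2 : ((A.updateCol 0 (Pi.single 0 1)).submatrix (q.succ.succAbove ∘ Fin.succ)
        (s.succ.succAbove ∘ Fin.succ)) = (A.submatrix (fun i => (q.succAbove i).succ)
        (fun j => (s.succAbove j).succ)) := by
        ext i j
        simp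
      rw [h2]
    · intro b _ hb
      obtain ⟨b, rfl⟩ := Fin.exists_succ_eq.2 hb
      simp
    · simp
  · intro b _ hb
    simp [hb]
  · simp

/-- Cramer's rule in division-free form: apply the adjugate to the linear system. -/
theorem last_mul_det_of_mulVec_eq_single {k : ℕ} (A : Matrix (Fin (k + 1)) (Fin (k + 1)) R)
    (e : Fin (k + 1) → R) (c : R) (h : A *ᵥ e = Pi.single (Fin.last k) c) :
    e (Fin.last k) * A.det = c * (A.submatrix Fin.castSucc Fin.castSucc).det := by
  have h1 : A.adjugate *ᵥ (A *ᵥ e) = A.det • e := by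
    rw [mulVec_mulVec, adjugate_mul, smul_mulVec, one_mulVec]
  have h2 := congrFun h1 (Fin.last k)
  rw [h, mulVec_single] at h2
  simp [adjugate_fin_succ_eq_det_submatrix] at h2
  rw [mul_comm, ← h2, mul_comm]

theorem hasDerivAt_det {M : ℝ → Matrix ι ι ℝ} {M' : Matrix ι ι ℝ} {t : ℝ}
    (h : ∀ i j, HasDerivAt (fun s => M s i j) (M' i j) t) :
    HasDerivAt (fun s => (M s).det) (∑ j, ((M t).updateCol j (fun i => M' i j)).det) t := by
  simp only [det_apply']
  rw [Finset.sum_comm]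
  refine HasDerivAt.fun_sum fun σ _ => ?_
  rw [← Finset.mul_sum]
  refine HasDerivAt.const_mul _ ?_
  convert HasDerivAt.fun_finsetProd (u := Finset.univ) (fun i _ => h (σ i) i) using 1
  refine Finset.sum_congr rfl fun j _ => ?_
  rw [← Finset.prod_erase_mul _ _ (Finset.mem_univ j)]
  simp only [updateCol_self, smul_eq_mul]
  congr 1
  refine Finset.prod_congr rfl fun i hi => ?_
  rw [updateCol_ne (Finset.ne_of_mem_erase hi)]

end Matrix

/-! ### Hankel determinants: identities, positivity, derivatives -/

namespace Peakon

/-- The Hankel determinant of size `k` of the sequence `f`, shifted by `l`. -/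
noncomputable def hankelDet (f : ℕ → ℝ) (l k : ℕ) : ℝ :=
  (Matrix.of fun i j : Fin k => f (l + i + j)).det

@[simp] theorem hankelDet_zero (f : ℕ → ℝ) (l : ℕ) : hankelDet f l 0 = 1 := by
  simp [hankelDet]

theorem neg_one_pow_add_self (k : ℕ) : (-1 : ℝ) ^ (k + k) = 1 := Even.neg_one_pow ⟨k, rfl⟩

/-- The Desnanot–Jacobi identity for Hankel determinants. -/
theorem hankelDet_desnanot (f : ℕ → ℝ) (l k : ℕ) :
    hankelDet f l (k + 2) * hankelDet f (l + 2) k =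
      hankelDet f l (k + 1) * hankelDet f (l + 2) (k + 1) - hankelDet f (l + 1) (k + 1) ^ 2 := by
  have h := Matrix.adjugate_mul_adjugate_sub (Matrix.of fun i j : Fin (k + 2) => f (l + i + j))
    (Fin.succ_ne_zero (Fin.last k)).symm 0 (Fin.last k).succ
  rw [Matrix.det_updateCol_zero_updateCol_succ] at h
  simp only [Matrix.adjugate_fin_succ_eq_det_submatrix, Fin.succ_last] at h
  have e1 : ((Matrix.of fun i j : Fin (k + 2) => f (l + i + j)).submatrix
      (Fin.succAbove 0) (Fin.succAbove 0)).det = hankelDet f (l + 2) (k + 1) := by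
    unfold hankelDet
    congr 1; ext i j
    simp only [Matrix.submatrix_apply, Matrix.of_apply, Fin.zero_succAbove, Fin.val_succ]
    congr 1; ring
  have e2 : ((Matrix.of fun i j : Fin (k + 2) => f (l + i + j)).submatrix
      (Fin.last (k + 1)).succAbove (Fin.last (k + 1)).succAbove).det = hankelDet f l (k + 1) := by
    unfold hankelDet
    congr 1; ext i j
    simp
  have e3 : ((Matrix.of fun i j : Fin (k + 2) => f (l + i + j)).submatrix
      (Fin.last (k + 1)).succAbove (Fin.succAbove 0)).det = hankelDet f (l + 1) (k + 1) := by
    unfold hankelDet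
    congr 1; ext i j
    simp only [Matrix.submatrix_apply, Matrix.of_apply, Fin.zero_succAbove, Fin.succAbove_last,
      Fin.val_succ, Fin.val_castSucc]
    congr 1; ring
  have e4 : ((Matrix.of fun i j : Fin (k + 2) => f (l + i + j)).submatrix
      (Fin.succAbove 0) (Fin.last (k + 1)).succAbove).det = hankelDet f (l + 1) (k + 1) := by
    unfold hankelDet
    congr 1; ext i j
    simp only [Matrix.submatrix_apply, Matrix.of_apply, Fin.zero_succAbove, Fin.succAbove_last,
      Fin.val_succ, Fin.val_castSucc]
    congr 1; ring
  have e5 : ((Matrix.of fun i j : Fin (k + 2) => f (l + i + j)).submatrix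
      (fun i => ((Fin.last k).succAbove i).succ) (fun i => ((Fin.last k).succAbove i).succ)).det =
      hankelDet f (l + 2) k := by
    unfold hankelDet
    congr 1; ext i j
    simp only [Matrix.submatrix_apply, Matrix.of_apply, Fin.succAbove_last,
      Fin.val_succ, Fin.val_castSucc]
    congr 1; ring
  rw [e1, e2, e3, e4, e5] at h
  change _ = hankelDet f l (k + 2) * _ at h
  simp only [Fin.val_last, Fin.val_zero, add_zero, zero_add, neg_one_pow_add_self, one_mul,
    pow_zero, Nat.succ_eq_add_one] at h
  rw [← h]
  have h3 : (-1 : ℝ) ^ (k + 1) * (-1) ^ (k + 1) = 1 := by rw [← pow_add, neg_one_pow_add_self]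
  linear_combination (-hankelDet f (l + 1) (k + 1) ^ 2) * h3

/-- Jacobi's identity for Δ^0_{k+2}, deleting the first and last rows and the first two columns; one
of the products contains Δ^1_{k+1} and drops out. The determinant with the altered column is, up to
a factor, the time derivative of Δ^1_{k+1}. -/
theorem hankelDet_mul_det_updateCol (f : ℕ → ℝ) (k : ℕ) (h0 : hankelDet f 1 (k + 1) = 0) :
    hankelDet f 2 (k + 1) * ((Matrix.of fun i j : Fin (k + 1) => f (1 + i + j)).updateCol 0
      (fun i => f i)).det = hankelDet f 0 (k + 2) * hankelDet f 3 k := by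
  have h := Matrix.adjugate_mul_adjugate_sub (Matrix.of fun i j : Fin (k + 2) => f (0 + i + j))
    (Fin.succ_ne_zero (0 : Fin (k + 1))).symm 0 (Fin.last k).succ
  rw [Matrix.det_updateCol_zero_updateCol_succ] at h
  simp only [Matrix.adjugate_fin_succ_eq_det_submatrix, Fin.succ_last] at h
  have e1 : ((Matrix.of fun i j : Fin (k + 2) => f (0 + i + j)).submatrix
      (Fin.succAbove 0) (Fin.succAbove 0)).det = hankelDet f 2 (k + 1) := by
    unfold hankelDet
    congr 1; ext i j
    simp only [Matrix.submatrix_apply, Matrix.of_apply, Fin.zero_succAbove, Fin.val_succ]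
    congr 1; ring
  have e3 : ((Matrix.of fun i j : Fin (k + 2) => f (0 + i + j)).submatrix
      (Fin.last (k + 1)).succAbove (Fin.succAbove 0)).det = hankelDet f 1 (k + 1) := by
    unfold hankelDet
    congr 1; ext i j
    simp only [Matrix.submatrix_apply, Matrix.of_apply, Fin.zero_succAbove, Fin.succAbove_last,
      Fin.val_succ, Fin.val_castSucc]
    congr 1; ring
  have e2 : ((Matrix.of fun i j : Fin (k + 2) => f (0 + i + j)).submatrix
      (Fin.last (k + 1)).succAbove (Fin.succAbove (Fin.succ 0))) =
      ((Matrix.of fun i j : Fin (k + 1) => f (1 + i + j)).updateCol 0 (fun i => f i)) := by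
    ext i j
    simp only [Matrix.submatrix_apply, Matrix.of_apply, Fin.succAbove_last,
      Fin.val_castSucc, Matrix.updateCol_apply]
    cases j using Fin.cases with
    | zero => simp
    | succ j =>
      simp only [Fin.succ_succAbove_succ, Fin.zero_succAbove, Fin.val_succ, Fin.succ_ne_zero,
        if_false]
      congr 1; ring
  have e5 : ((Matrix.of fun i j : Fin (k + 2) => f (0 + i + j)).submatrix
      (fun i => ((Fin.last k).succAbove i).succ) (fun i => (Fin.succAbove 0 i).succ)).det =
      hankelDet f 3 k := by
    unfold hankelDet
    congr 1; ext i j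
    simp only [Matrix.submatrix_apply, Matrix.of_apply, Fin.succAbove_last, Fin.zero_succAbove,
      Fin.val_succ, Fin.val_castSucc]
    congr 1; ring
  rw [e1, e2, e3, e5, h0] at h
  change _ = hankelDet f 0 (k + 2) * _ at h
  simp only [Fin.val_last, Fin.val_zero, add_zero, zero_add, one_mul,
    pow_zero, mul_zero, Fin.val_succ, sub_zero] at h
  have h3 : (-1 : ℝ) ^ k * (-1) ^ k = 1 := by rw [← pow_add, neg_one_pow_add_self]
  have h4 : (-1 : ℝ) ^ (k + 1 + 1) = (-1) ^ k := by ring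
  rw [h4] at h
  linear_combination ((-1) ^ k) * h + (hankelDet f 0 (k + 2) * hankelDet f 3 k -
    hankelDet f 2 (k + 1) * ((Matrix.of fun i j : Fin (k + 1) => f (1 + i + j)).updateCol 0
      (fun i => f i)).det) * h3

/-- The effect on a Hankel determinant of changing the first term of the sequence. -/
theorem hankelDet_eq_add (f g : ℕ → ℝ) (c : ℝ) (h0 : f 0 = g 0 + c)
    (h : ∀ k, f (k + 1) = g (k + 1)) (k : ℕ) :
    hankelDet f 0 (k + 1) = hankelDet g 0 (k + 1) + c * hankelDet g 2 k := by
  unfold hankelDet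
  rw [Matrix.det_succ_column_zero, Matrix.det_succ_column_zero, Fin.sum_univ_succ,
    Fin.sum_univ_succ]
  have hs : ∀ i : Fin (k + 1),
      ((Matrix.of fun i j : Fin (k + 1) => f (0 + i + j)).submatrix i.succAbove Fin.succ) =
      ((Matrix.of fun i j : Fin (k + 1) => g (0 + i + j)).submatrix i.succAbove Fin.succ) := by
    intro i; ext a b
    simp [← add_assoc, h]
  have hz : ((Matrix.of fun i j : Fin (k + 1) => g (0 + i + j)).submatrix
      (Fin.succAbove 0) Fin.succ) = Matrix.of fun i j : Fin k => g (2 + i + j) := by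
    ext a b
    simp only [Matrix.submatrix_apply, Matrix.of_apply, Fin.zero_succAbove, Fin.val_succ]
    congr 1; ring
  simp only [hs]
  rw [hz]
  simp only [Matrix.of_apply, Fin.val_zero, Fin.val_succ, zero_add, add_zero, h, h0,
    pow_zero]
  ring

theorem hankelDet_congr {f g : ℕ → ℝ} {l : ℕ} (h : ∀ k, f (l + k) = g (l + k)) (k : ℕ) :
    hankelDet f l k = hankelDet g l k := by
  simp only [hankelDet, add_assoc, h]

/-- Read `e` as the coefficients of a polynomial of degree at most `k` that is orthogonal to the
lower powers: its leading coefficient is then a ratio of Hankel determinants. -/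
theorem hankelDet_cramer (f : ℕ → ℝ) (l k : ℕ) (e : ℕ → ℝ) (c : ℝ)
    (h : ∀ r ≤ k, ∑ i ∈ Finset.range (k + 1), f (l + r + i) * e i = if r = k then c else 0) :
    e k * hankelDet f l (k + 1) = c * hankelDet f l k := by
  have := Matrix.last_mul_det_of_mulVec_eq_single (Matrix.of fun i j : Fin (k + 1) => f (l + i + j))
    (fun i => e i) c (by
      ext r
      have := h r (Nat.lt_succ_iff.1 r.2)
      rw [Finset.sum_range] at this
      simp only [Matrix.mulVec, dotProduct, Matrix.of_apply, Pi.single_apply, this, Fin.ext_iff,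
        Fin.val_last])
  simpa [hankelDet, Matrix.submatrix] using this

/-- Hankel determinants of the moments of a positive measure are positive. -/
theorem hankelDet_pos {ι : Type*} [Fintype ι] (w μ : ι → ℝ) (hw : ∀ i, 0 < w i)
    (hμ : Function.Injective μ) {f : ℕ → ℝ} {l : ℕ} (hf : ∀ k, f (l + k) = ∑ i, w i * μ i ^ k)
    {k : ℕ} (hk : k ≤ Fintype.card ι) : 0 < hankelDet f l k := by
  classical
  let V : Matrix ι (Fin k) ℝ := Matrix.of fun i j => μ i ^ (j : ℕ)
  -- A Gram matrix with a rectangular Vandermonde factor `V`. The kernel of `V` is trivial because a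
  -- nonzero polynomial of degree below `k` cannot vanish at `k` or more distinct nodes.
  have hM : (Matrix.of fun i j : Fin k => f (l + i + j)) =
      V.conjTranspose * Matrix.diagonal w * V := by
    ext i j
    simp only [Matrix.of_apply, add_assoc, hf, Matrix.mul_apply (M := _ * _), Matrix.mul_diagonal, V,
      Matrix.conjTranspose_apply, star_trivial]
    exact Finset.sum_congr rfl fun a _ => by ring
  unfold hankelDet
  rw [hM]
  refine Matrix.PosDef.det_pos ?_
  refine Matrix.PosDef.conjTranspose_mul_mul_same (Matrix.PosDef.diagonal hw) ?_
  rw [← Matrix.coe_mulVecLin, ← LinearMap.ker_eq_bot, LinearMap.ker_eq_bot']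
  intro v hv
  let p : Polynomial ℝ := ∑ j : Fin k, Polynomial.C (v j) * Polynomial.X ^ (j : ℕ)
  have hp : ∀ i, p.eval (μ i) = 0 := by
    intro i
    have := congrFun hv i
    simp only [Matrix.mulVecLin_apply, Matrix.mulVec, dotProduct, V, Matrix.of_apply,
      Pi.zero_apply] at this
    simp only [p, Polynomial.eval_finsetSum, Polynomial.eval_mul, Polynomial.eval_C,
      Polynomial.eval_pow, Polynomial.eval_X]
    rw [← this]
    exact Finset.sum_congr rfl fun a _ => by ring
  have hdeg : p.degree < k := Polynomial.degree_sum_fin_lt v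
  have h0 : p = 0 := by
    refine Polynomial.eq_zero_of_degree_lt_of_eval_finset_eq_zero
      (Finset.univ.image μ) ?_ ?_
    · rw [Finset.card_image_of_injective _ hμ, Finset.card_univ]
      exact hdeg.trans_le (by exact_mod_cast hk)
    · simpa using hp
  ext j
  have := congrArg (fun q => Polynomial.coeff q j) h0
  simpa [p, Polynomial.finsetSum_coeff, Polynomial.coeff_C_mul, Polynomial.coeff_X_pow,
    Fin.val_inj] using this

/-- The Hankel determinant whose size is the number of atoms does not vanish. -/
theorem hankelDet_ne_zero {n : ℕ} (w μ : Fin n → ℝ) (hw : ∀ i, w i ≠ 0)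
    (hμ : Function.Injective μ) {f : ℕ → ℝ} {l : ℕ} (hf : ∀ k, f (l + k) = ∑ i, w i * μ i ^ k) :
    hankelDet f l n ≠ 0 := by
  have hM : (Matrix.of fun i j : Fin n => f (l + i + j)) =
      (Matrix.vandermonde μ).transpose * Matrix.diagonal w * Matrix.vandermonde μ := by
    ext i j
    simp only [Matrix.of_apply, add_assoc, hf, Matrix.mul_apply (M := _ * _), Matrix.mul_diagonal,
      Matrix.transpose_apply, Matrix.vandermonde_apply]
    exact Finset.sum_congr rfl fun a _ => by ring
  unfold hankelDet
  rw [hM, Matrix.det_mul, Matrix.det_mul, Matrix.det_transpose, Matrix.det_diagonal]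
  have := Matrix.det_vandermonde_ne_zero_iff.2 hμ
  have := Finset.prod_ne_zero_iff.2 fun i (_ : i ∈ Finset.univ) => hw i
  positivity

/-- The derivative of `Δ^1_k` if the derivative of the moments is a multiple of the shift. -/
theorem hasDerivAt_hankelDet_one {f : ℝ → ℕ → ℝ} {t c : ℝ}
    (h : ∀ k, HasDerivAt (fun s => f s (k + 1)) (c * f t k) t) (k : ℕ) :
    HasDerivAt (fun s => hankelDet (f s) 1 (k + 1))
      (c * ((Matrix.of fun i j : Fin (k + 1) => f t (1 + i + j)).updateCol 0
      (fun i => f t i)).det) t := by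
  have := Matrix.hasDerivAt_det (M := fun s => Matrix.of fun i j : Fin (k + 1) => f s (1 + i + j))
    (M' := Matrix.of fun i j : Fin (k + 1) => c * f t (i + j)) (t := t) (fun i j => by
      have := h (i + j)
      simp only [Matrix.of_apply, show 1 + (i : ℕ) + j = i + j + 1 by ring]
      exact this)
  unfold hankelDet
  convert this using 1
  -- The derivative of column j + 1 is `c` times column j, so every term but the first has two
  -- proportional columns.
  rw [Fin.sum_univ_succ, Finset.sum_eq_zero, add_zero]
  · rw [← Matrix.det_updateCol_smul]
    rfl
  · intro j _
    rw [show (fun i : Fin (k + 1) => (Matrix.of fun i j : Fin (k + 1) => c * f t (i + j)) i j.succ)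
      = c • (fun i : Fin (k + 1) => f t (1 + i + (j.castSucc : Fin (k + 1)))) from ?_,
      Matrix.det_updateCol_smul, Matrix.det_zero_of_column_eq (i := j.succ) (j := j.castSucc),
      mul_zero]
    · exact Fin.castSucc_lt_succ.ne'
    · intro i
      rw [Matrix.updateCol_self, Matrix.updateCol_ne Fin.castSucc_lt_succ.ne]
      simp
    · ext i
      simp only [Matrix.of_apply, Fin.val_succ, Pi.smul_apply, Fin.val_castSucc, smul_eq_mul]
      congr 2; ring

theorem differentiable_hankelDet {f : ℝ → ℕ → ℝ} (h : ∀ k, Differentiable ℝ fun s => f s k)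
    (l k : ℕ) : Differentiable ℝ fun s => hankelDet (f s) l k := fun t =>
  (Matrix.hasDerivAt_det (M := fun s => Matrix.of fun i j : Fin k => f s (l + i + j))
    (M' := Matrix.of fun i j : Fin k => deriv (fun s => f s (l + i + j)) t)
    fun _ _ => (h _ t).hasDerivAt).differentiableAt

/-! ### The string as a polynomial recursion, and Stieltjes' formulas -/

open Polynomial in
/-- The values and slopes of the piecewise linear wave function, as polynomials in `z`. -/
noncomputable def wavePoly (l g : ℕ → ℝ) : ℕ → ℝ[X] × ℝ[X]
  | 0 => (0, 1)
  | j + 1 =>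
    ((wavePoly l g j).1 + C (l j) * (wavePoly l g j).2,
      (wavePoly l g j).2 + C (g (j + 1)) * (X *
        ((wavePoly l g j).1 + C (l j) * (wavePoly l g j).2)))

open Polynomial in
/-- The coefficients expressing the value at `y_{n-k+1}` and the slope on `(y_{n-k}, y_{n-k+1})`
of a solution that vanishes at the right end point in terms of its last slope. -/
noncomputable def backPoly (l g : ℕ → ℝ) (n : ℕ) : ℕ → ℝ[X] × ℝ[X]
  | 0 => (0, 1)
  | k + 1 =>
    ((backPoly l g n k).1 - C (l (n - k)) * (backPoly l g n k).2,
      (backPoly l g n k).2 - C (g (n - k)) * (X *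
        ((backPoly l g n k).1 - C (l (n - k)) * (backPoly l g n k).2)))

section

variable (l g : ℕ → ℝ) (n : ℕ)

theorem wavePoly_succ_snd (j : ℕ) : (wavePoly l g (j + 1)).2 =
    (wavePoly l g j).2 + Polynomial.C (g (j + 1)) * (Polynomial.X * (wavePoly l g (j + 1)).1) := rfl

theorem backPoly_succ_snd (k : ℕ) : (backPoly l g n (k + 1)).2 = (backPoly l g n k).2 -
    Polynomial.C (g (n - k)) * (Polynomial.X * (backPoly l g n (k + 1)).1) := rfl

theorem wavePoly_succ_fst (j : ℕ) : (wavePoly l g (j + 1)).1 =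
    (wavePoly l g j).1 + Polynomial.C (l j) * (wavePoly l g j).2 := rfl

theorem backPoly_succ_fst (k : ℕ) : (backPoly l g n (k + 1)).1 = (backPoly l g n k).1 -
    Polynomial.C (l (n - k)) * (backPoly l g n k).2 := rfl

theorem coeff_wavePoly_eq_zero (j : ℕ) :
    (∀ i ≥ j, (wavePoly l g j).1.coeff i = 0) ∧ ∀ i > j, (wavePoly l g j).2.coeff i = 0 := by
  induction j with
  | zero =>
    refine ⟨by simp [wavePoly], fun i hi => ?_⟩
    simp [wavePoly, Polynomial.coeff_one, hi.ne']
  | succ j ih =>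
    have h1 : ∀ i ≥ j + 1, (wavePoly l g (j + 1)).1.coeff i = 0 := by
      intro i hi
      rw [wavePoly_succ_fst]
      simp [ih.1 i (by omega), ih.2 i (by omega)]
    refine ⟨h1, fun i hi => ?_⟩
    obtain ⟨i, rfl⟩ : ∃ i', i = i' + 1 := ⟨i - 1, by omega⟩
    rw [wavePoly_succ_snd, Polynomial.coeff_add, Polynomial.coeff_C_mul, Polynomial.coeff_X_mul,
      h1 i (by omega), ih.2 _ (by omega)]
    simp

theorem coeff_backPoly_eq_zero (j : ℕ) :
    (∀ i ≥ j, (backPoly l g n j).1.coeff i = 0) ∧ ∀ i > j, (backPoly l g n j).2.coeff i = 0 := by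
  induction j with
  | zero =>
    refine ⟨by simp [backPoly], fun i hi => ?_⟩
    simp [backPoly, Polynomial.coeff_one, hi.ne']
  | succ j ih =>
    have h1 : ∀ i ≥ j + 1, (backPoly l g n (j + 1)).1.coeff i = 0 := by
      intro i hi
      rw [backPoly_succ_fst]
      simp [ih.1 i (by omega), ih.2 i (by omega)]
    refine ⟨h1, fun i hi => ?_⟩
    obtain ⟨i, rfl⟩ : ∃ i', i = i' + 1 := ⟨i - 1, by omega⟩
    rw [backPoly_succ_snd, Polynomial.coeff_sub, Polynomial.coeff_C_mul, Polynomial.coeff_X_mul,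
      h1 i (by omega), ih.2 _ (by omega)]
    simp

theorem coeff_wavePoly_fst (j : ℕ) :
    (wavePoly l g (j + 1)).1.coeff j = l j * (wavePoly l g j).2.coeff j := by
  rw [wavePoly_succ_fst, Polynomial.coeff_add, (coeff_wavePoly_eq_zero l g j).1 j le_rfl]
  simp

theorem coeff_wavePoly_snd (j : ℕ) :
    (wavePoly l g (j + 1)).2.coeff (j + 1) = g (j + 1) * (wavePoly l g (j + 1)).1.coeff j := by
  rw [wavePoly_succ_snd, Polynomial.coeff_add, (coeff_wavePoly_eq_zero l g j).2 _ (by omega)]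
  simp [Polynomial.coeff_X_mul]

theorem coeff_backPoly_fst (j : ℕ) :
    (backPoly l g n (j + 1)).1.coeff j = - (l (n - j) * (backPoly l g n j).2.coeff j) := by
  rw [backPoly_succ_fst, Polynomial.coeff_sub, (coeff_backPoly_eq_zero l g n j).1 j le_rfl]
  simp

theorem coeff_backPoly_snd (j : ℕ) : (backPoly l g n (j + 1)).2.coeff (j + 1) =
    g (n - j) * l (n - j) * (backPoly l g n j).2.coeff j := by
  rw [backPoly_succ_snd, Polynomial.coeff_sub, (coeff_backPoly_eq_zero l g n j).2 _ (by omega),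
    Polynomial.coeff_C_mul, Polynomial.coeff_X_mul, coeff_backPoly_fst]
  ring

/-- The solution of the string equation at an eigenvalue, from the right. -/
theorem eval_wavePoly_eq (z : ℝ) (hz : z * (wavePoly l g (n + 1)).1.eval z = 0) (k d : ℕ)
    (hn : n = k + d) :
    (wavePoly l g d).2.eval z = (backPoly l g n k).2.eval z * (wavePoly l g n).2.eval z ∧
    z * (wavePoly l g (d + 1)).1.eval z =
      z * ((backPoly l g n k).1.eval z * (wavePoly l g n).2.eval z) := by
  -- The slope recursion sees the value φ only through zφ. Keeping the factor `z` thus admits the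
  -- node z = 0, where φ(1, z) itself need not vanish.
  induction k generalizing d with
  | zero =>
    obtain rfl : n = d := by omega
    simp [backPoly, hz]
  | succ k ih =>
    obtain ⟨h2, h1⟩ := ih (d + 1) (by omega)
    have hk : n - k = d + 1 := by omega
    have e1 : z * (wavePoly l g (d + 1)).1.eval z =
      z * ((backPoly l g n (k + 1)).1.eval z * (wavePoly l g n).2.eval z) := by
      rw [backPoly_succ_fst, hk]
      rw [wavePoly_succ_fst l g (d + 1)] at h1
      simp only [Polynomial.eval_add, Polynomial.eval_sub, Polynomial.eval_mul,
        Polynomial.eval_C] at h1 ⊢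
      linear_combination h1 - z * l (d + 1) * h2
    refine ⟨?_, e1⟩
    rw [backPoly_succ_snd, hk]
    rw [wavePoly_succ_snd l g d] at h2
    simp only [Polynomial.eval_add, Polynomial.eval_sub, Polynomial.eval_mul,
        Polynomial.eval_C, Polynomial.eval_X] at h2 ⊢
    linear_combination h2 - g (d + 1) * e1

end

/-- Lagrange interpolation expresses the top coefficient as the sum of P(ν_j) / ∏ (ν_j - ν_i), and
`hS` turns these denominators into the weights `a`. Sums against `a` thus become coefficients, which
vanish when the degree is too low. -/
theorem sum_mul_eval_eq_coeff {n : ℕ} {ν a : Fin (n + 1) → ℝ} (hν : Function.Injective ν) {c : ℝ}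
    {S : ℝ → ℝ} (hS : ∀ j, S (ν j) = c * (a j * ∏ i ∈ Finset.univ.erase j, (ν j - ν i)))
    (P : Polynomial ℝ) (hP : ∀ i > n, P.coeff i = 0) (p : ℝ → ℝ)
    (h : ∀ j, P.eval (ν j) = p (ν j) * S (ν j)) :
    c * ∑ j, a j * p (ν j) = P.coeff n := by
  have := Lagrange.coeff_eq_sum (s := Finset.univ) (v := ν) hν.injOn (P := P) (by
    rw [Finset.card_univ, Fintype.card_fin, Polynomial.degree_lt_iff_coeff_zero]
    intro m hm
    exact hP m (by omega))
  rw [Finset.card_univ, Fintype.card_fin, Nat.add_sub_cancel] at this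
  rw [this, Finset.mul_sum]
  refine Finset.sum_congr rfl fun j _ => ?_
  have hne : ∏ i ∈ Finset.univ.erase j, (ν j - ν i) ≠ 0 :=
    Finset.prod_ne_zero_iff.2 fun i hi => sub_ne_zero.2 fun h =>
      (Finset.ne_of_mem_erase hi) (hν h).symm
  rw [h, hS]
  field_simp

/-- Pairing moments with coefficients is integration against the discrete measure; the signs arise
because the moments are taken in -ν. -/
theorem sum_moment_mul_coeff {N : ℕ} {ν a : Fin N → ℝ} {f : ℕ → ℝ}
    (hf : ∀ k, f k = ∑ j, a j * (-ν j) ^ k) (p : Polynomial ℝ) (k s : ℕ)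
    (hp : ∀ i > k, p.coeff i = 0) :
    ∑ i ∈ Finset.range (k + 1), f (s + i) * ((-1) ^ i * p.coeff i) =
      (-1) ^ s * ∑ j, a j * (ν j ^ s * p.eval (ν j)) := by
  have he : ∀ z, p.eval z = ∑ i ∈ Finset.range (k + 1), p.coeff i * z ^ i := fun z =>
    Polynomial.eval_eq_sum_range' (Nat.lt_succ_of_le (Polynomial.natDegree_le_iff_coeff_eq_zero.2
      fun N hN => hp N hN)) z
  simp only [hf, he, Finset.mul_sum, Finset.sum_mul]
  rw [Finset.sum_comm]
  refine Finset.sum_congr rfl fun j _ => Finset.sum_congr rfl fun i _ => ?_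
  have h1 : (-1 : ℝ) ^ i * (-1) ^ i = 1 := by rw [← pow_add, neg_one_pow_add_self]
  rw [neg_pow, pow_add, pow_add]
  linear_combination (a j * (-1) ^ s * ν j ^ s * ν j ^ i * p.coeff i) * h1

/-- Stieltjes' formulas for the lengths and masses of a discrete string. -/
theorem string_eq_hankelDet (n : ℕ) (l g : ℕ → ℝ) (ν a : Fin (n + 1) → ℝ)
    (hν : Function.Injective ν) (hl : ∀ j ≤ n, l j ≠ 0) (hg : ∀ j < n, g (j + 1) ≠ 0)
    (hΦ : ∀ j, ν j * (wavePoly l g (n + 1)).1.eval (ν j) = 0)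
    (hS : ∀ j, (wavePoly l g n).2.eval (ν j) = (wavePoly l g (n + 1)).1.coeff n *
      (a j * ∏ i ∈ Finset.univ.erase j, (ν j - ν i)))
    (f : ℕ → ℝ) (hf : ∀ k, f k = ∑ j, a j * (-ν j) ^ k)
    (h0 : ∀ k ≤ n, hankelDet f 0 k ≠ 0) (k d : ℕ) (hn : n = k + d) :
    l d * (hankelDet f 0 k * hankelDet f 0 (k + 1)) = hankelDet f 1 k ^ 2 ∧
    (∀ d', d = d' + 1 → g d * (hankelDet f 1 (k + 1) * hankelDet f 1 k) =
      hankelDet f 0 (k + 1) ^ 2) := by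
  set c := (wavePoly l g (n + 1)).1.coeff n with hc
  set σ : ℕ → ℝ := fun j => (wavePoly l g j).2.coeff j with hσdef
  set b : ℕ → ℝ := fun k => (backPoly l g n k).2.coeff k with hbdef
  have hσ0 : σ 0 = 1 := by simp [hσdef, wavePoly]
  have hb0 : b 0 = 1 := by simp [hbdef, backPoly]
  have hσs : ∀ j, σ (j + 1) = g (j + 1) * (l j * σ j) := fun j => by
    simp only [hσdef, coeff_wavePoly_snd, coeff_wavePoly_fst]
  have hbs : ∀ j, b (j + 1) = g (n - j) * l (n - j) * b j := fun j => coeff_backPoly_snd l g n j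
  have hσne : ∀ j ≤ n, σ j ≠ 0 := by
    intro j
    induction j with
    | zero => simp [hσ0]
    | succ j ih =>
      intro hj
      rw [hσs]
      exact mul_ne_zero (hg j (by omega)) (mul_ne_zero (hl j (by omega)) (ih (by omega)))
  have hcn : c = l n * σ n := coeff_wavePoly_fst l g n
  have hc0 : c ≠ 0 := by rw [hcn]; exact mul_ne_zero (hl n le_rfl) (hσne n le_rfl)
  -- Both sides are the product of all lengths and masses; the piece `d` separates the forward
  -- recursion from the backward one.
  have hbσ : ∀ k d, n = k + d → b k * l d * σ d = c := by
    intro k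
    induction k with
    | zero => intro d hd; obtain rfl : n = d := by omega
              rw [hb0, hcn]; ring
    | succ k ih =>
      intro d hd
      rw [← ih (d + 1) (by omega), hbs, hσs, show n - k = d + 1 by omega]
      ring
  have hbne : ∀ k d, n = k + d → b k ≠ 0 := fun k d hd h => hc0 (by
    rw [← hbσ k d hd, h]; ring)
  -- Orthogonality: at the nodes, the backward slope polynomial times the last slope is the forward
  -- slope on piece `d`, of degree at most d = n - k. Times z^r, it has no coefficient of order n
  -- for r < k, and has σ d for r = k.
  have hA : ∀ k d, n = k + d → l d * b k ^ 2 * hankelDet f 0 (k + 1) = hankelDet f 0 k := by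
    intro k d hd
    have key : b k * hankelDet f 0 (k + 1) * c = σ d * hankelDet f 0 k := by
      have h1 := hankelDet_cramer f 0 k (fun i => (-1) ^ i * (backPoly l g n k).2.coeff i)
        ((-1) ^ k * (σ d / c)) (fun r hr => by
          rw [sum_moment_mul_coeff hf _ _ _ (coeff_backPoly_eq_zero l g n k).2, zero_add]
          have h2 := sum_mul_eval_eq_coeff hν (S := fun z => (wavePoly l g n).2.eval z) hS
            (Polynomial.X ^ r * (wavePoly l g d).2) (fun i hi => by
              obtain ⟨i, rfl⟩ := Nat.exists_eq_add_of_le' (show r ≤ i by omega)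
              rw [Polynomial.coeff_X_pow_mul]
              exact (coeff_wavePoly_eq_zero l g d).2 i (by omega))
            (fun z => z ^ r * (backPoly l g n k).2.eval z) (fun j => by
              simp only [Polynomial.eval_mul, Polynomial.eval_pow, Polynomial.eval_X]
              rw [(eval_wavePoly_eq l g n (ν j) (hΦ j) k d hd).1]
              ring)
          have h3 : (Polynomial.X ^ r * (wavePoly l g d).2).coeff n = if r = k then σ d else 0 := by
            rw [show n = (n - r) + r by omega, Polynomial.coeff_X_pow_mul]
            split_ifs with h
            · rw [show n - r = d by omega]
            · exact (coeff_wavePoly_eq_zero l g d).2 _ (by omega)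
          rw [h3] at h2
          rw [← mul_right_inj' hc0, mul_left_comm, h2]
          split_ifs with h
          · rw [h]; field_simp
          · simp)
      have h2 : ((-1 : ℝ) ^ k) ≠ 0 := by positivity
      rw [mul_assoc, mul_assoc, mul_right_inj' h2] at h1
      change b k * _ = _ at h1
      rw [h1]
      field_simp
    have := hbσ k d hd
    rw [← mul_right_inj' hc0]
    linear_combination (l d * b k) * key + hankelDet f 0 k * this
  -- The same for the values instead of the slopes. The extra factor z in `eval_wavePoly_eq` shifts
  -- the moments by one, which brings in Δ^1.
  have hB : ∀ k d, n = k + (d + 1) →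
      l (d + 1) * b k * (b (k + 1) * hankelDet f 1 (k + 1)) = hankelDet f 1 k := by
    intro k d hd
    have key : l (d + 1) * b k * hankelDet f 1 (k + 1) * c = l d * σ d * hankelDet f 1 k := by
      have h1 := hankelDet_cramer f 1 k (fun i => (-1) ^ i * (backPoly l g n (k + 1)).1.coeff i)
        ((-1) ^ (k + 1) * (l d * σ d / c)) (fun r hr => by
          rw [sum_moment_mul_coeff hf _ _ _ (fun i hi =>
            (coeff_backPoly_eq_zero l g n (k + 1)).1 i hi)]
          have h2 := sum_mul_eval_eq_coeff hν (S := fun z => (wavePoly l g n).2.eval z) hS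
            (Polynomial.X ^ (1 + r) * (wavePoly l g (d + 1)).1) (fun i hi => by
              obtain ⟨i, rfl⟩ := Nat.exists_eq_add_of_le' (show 1 + r ≤ i by omega)
              rw [Polynomial.coeff_X_pow_mul]
              exact (coeff_wavePoly_eq_zero l g (d + 1)).1 i (by omega))
            (fun z => z ^ (1 + r) * (backPoly l g n (k + 1)).1.eval z) (fun j => by
              simp only [Polynomial.eval_mul, Polynomial.eval_pow, Polynomial.eval_X]
              have := (eval_wavePoly_eq l g n (ν j) (hΦ j) (k + 1) d (by omega)).2
              linear_combination (ν j ^ r) * this)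
          have h3 : (Polynomial.X ^ (1 + r) * (wavePoly l g (d + 1)).1).coeff n =
              if r = k then l d * σ d else 0 := by
            rw [show n = (n - (1 + r)) + (1 + r) by omega, Polynomial.coeff_X_pow_mul]
            split_ifs with h
            · rw [show n - (1 + r) = d by omega, coeff_wavePoly_fst]
            · exact (coeff_wavePoly_eq_zero l g (d + 1)).1 _ (by omega)
          rw [h3] at h2
          rw [← mul_right_inj' hc0, mul_left_comm, h2]
          split_ifs with h
          · rw [h, add_comm 1 k]; field_simp
          · simp)
      rw [coeff_backPoly_fst, show n - k = d + 1 by omega] at h1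
      have h2 : ((-1 : ℝ) ^ k) ≠ 0 := by positivity
      rw [mul_assoc, mul_assoc, pow_succ, mul_assoc, mul_right_inj' h2] at h1
      change -(l (d + 1) * b k) * _ = _ at h1
      rw [← neg_inj]
      calc _ = -(l (d + 1) * b k) * hankelDet f 1 (k + 1) * c := by ring
        _ = _ := by rw [h1]; field_simp
    have h3 := hbσ k (d + 1) hd
    have h4 := hbs k
    rw [show n - k = d + 1 by omega] at h4
    rw [hσs] at h3
    rw [← mul_right_inj' hc0]
    rw [h4]
    linear_combination (g (d + 1) * l (d + 1) * b k) * key + hankelDet f 1 k * h3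
  have hbD : ∀ k d, n = k + d → b k * hankelDet f 1 k = hankelDet f 0 k := by
    intro k
    induction k with
    | zero => intro d hd; simp [hb0]
    | succ k ih =>
      intro d hd
      have i1 := ih (d + 1) (by omega)
      have i2 := hA k (d + 1) (by omega)
      have i3 := hB k d (by omega)
      have i4 := hbne k (d + 1) (by omega)
      have i5 := hl (d + 1) (by omega)
      have : l (d + 1) * b k ^ 2 ≠ 0 := by positivity
      rw [← mul_right_inj' this]
      linear_combination b k * i3 + i1 - i2
  have j1 := hA k d hn
  have j2 := hbD k d hn
  have j3 := h0 k (by omega)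
  refine ⟨?_, ?_⟩
  · rw [← mul_right_inj' j3]
    rw [← j2] at j1 ⊢
    linear_combination hankelDet f 1 k ^ 2 * j1
  · rintro d rfl
    have j4 := hbD (k + 1) d (by omega)
    have j5 := hbne k (d + 1) hn
    have j6 := hbs k
    rw [show n - k = d + 1 by omega] at j6
    rw [← mul_right_inj' j5]
    have : hankelDet f 1 k = l (d + 1) * b k * hankelDet f 0 (k + 1) := by
      rw [← mul_right_inj' j5, j2, ← j1]; ring
    rw [this, ← j4, j6]
    ring

/-! ### From the string on [-1, 1] to the line -/

theorem wave_eq_eval (n : ℕ) (x m : ℕ → ℝ) (z : ℝ) (j : ℕ) :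
    wave n x m z j = ((wavePoly (stringL n x) (stringG n x m) j).1.eval z,
      (wavePoly (stringL n x) (stringG n x m) j).2.eval z) := by
  induction j with
  | zero => simp [wave, wavePoly]
  | succ j ih =>
    simp only [wave, wavePoly, ih, Prod.mk.injEq, Polynomial.eval_add, Polynomial.eval_mul,
      Polynomial.eval_C, Polynomial.eval_X, true_and]
    ring

theorem one_add_tanh (x : ℝ) :
    1 + Real.tanh x = (1 - Real.tanh x) * Real.exp (2 * x) := by
  have h := (Real.cosh_pos x).ne'
  rw [Real.tanh_eq_sinh_div_cosh]
  field_simp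
  rw [two_mul, Real.exp_add, Real.cosh_add_sinh, Real.cosh_sub_sinh, ← mul_assoc, ← Real.exp_add]
  simp

theorem one_sub_tanh_pos (x : ℝ) : 0 < 1 - Real.tanh x := by
  linarith [Real.tanh_lt_one x]

theorem one_add_tanh_pos (x : ℝ) : 0 < 1 + Real.tanh x := by
  linarith [Real.neg_one_lt_tanh x]

/-- On `(x_j, x_{j+1})` the wave function in the variable `x`, the solution of
`ψ'' = ψ + z (∑ m_i δ_{x_i}) ψ` that equals `exp x` near `-∞`, is `A exp x + B exp (-x)`.
This is the pair `(A, B)`. -/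
noncomputable def expCoeff (x m : ℕ → ℝ) (z : ℝ) : ℕ → ℝ × ℝ
  | 0 => (1, 0)
  | j + 1 =>
    ((expCoeff x m z j).1 + z * m (j + 1) / 2 *
        ((expCoeff x m z j).1 + (expCoeff x m z j).2 * Real.exp (-2 * x (j + 1))),
      (expCoeff x m z j).2 - z * m (j + 1) / 2 *
        ((expCoeff x m z j).1 * Real.exp (2 * x (j + 1)) + (expCoeff x m z j).2))

/-- Liouville transformation y = tanh x, φ = ψ / cosh x: since 1 ± tanh x = exp(±x) / cosh x, the
piece A exp x + B exp(-x) becomes A(1 + y) + B(1 - y). -/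
theorem wave_eq_expCoeff (n : ℕ) (x m : ℕ → ℝ) (z : ℝ) (j : ℕ) (hj : j ≤ n) :
    wave n x m z j = ((expCoeff x m z j).1 * (1 + stringY n x j) +
      (expCoeff x m z j).2 * (1 - stringY n x j),
      (expCoeff x m z j).1 - (expCoeff x m z j).2) := by
  induction j with
  | zero => simp [wave, expCoeff, stringY]
  | succ j ih =>
    have hy : stringY n x (j + 1) = Real.tanh (x (j + 1)) := by simp [stringY, hj]
    have hm := one_sub_tanh_pos (x (j + 1))
    have hp := one_add_tanh_pos (x (j + 1))
    have he := one_add_tanh (x (j + 1))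
    have hexp : Real.exp (-2 * x (j + 1)) = (Real.exp (2 * x (j + 1)))⁻¹ := by
      rw [← Real.exp_neg]; ring_nf
    have hE := Real.exp_pos (2 * x (j + 1))
    simp only [wave, ih (by omega), stringL, stringG, expCoeff, hexp, hy]
    set A := (expCoeff x m z j).1
    set B := (expCoeff x m z j).2
    set y := Real.tanh (x (j + 1))
    set e := Real.exp (2 * x (j + 1))
    have he' : e = (1 + y) / (1 - y) := by field_simp; linarith
    have hy2 : 1 - y ^ 2 ≠ 0 := by
      have : 1 - y ^ 2 = (1 - y) * (1 + y) := by ring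
      rw [this]; positivity
    rw [he', Prod.mk.injEq]
    constructor
    · field_simp
      ring
    · have : 1 - y ^ 2 = (1 - y) * (1 + y) := by ring
      rw [this]
      field_simp
      ring

theorem waveEnd_eq_expCoeff (n : ℕ) (x m : ℕ → ℝ) (z : ℝ) :
    waveEnd n x m z = 2 * (expCoeff x m z n).1 := by
  simp only [waveEnd, wave, wave_eq_expCoeff n x m z n le_rfl, stringL]
  have : stringY n x (n + 1) = 1 := by simp [stringY]
  rw [this]; ring

theorem waveEndSlope_eq_expCoeff (n : ℕ) (x m : ℕ → ℝ) (z : ℝ) :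
    waveEndSlope n x m z = (expCoeff x m z n).1 - (expCoeff x m z n).2 := by
  simp only [waveEndSlope, wave_eq_expCoeff n x m z n le_rfl]

theorem expCoeff_zero (x m : ℕ → ℝ) (j : ℕ) : expCoeff x m 0 j = (1, 0) := by
  induction j with
  | zero => rfl
  | succ j ih => simp [expCoeff, ih]

theorem waveEnd_zero (n : ℕ) (x m : ℕ → ℝ) : waveEnd n x m 0 = 2 := by
  simp [waveEnd_eq_expCoeff, expCoeff_zero]

theorem waveEndSlope_zero (n : ℕ) (x m : ℕ → ℝ) : waveEndSlope n x m 0 = 1 := by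
  simp [waveEndSlope_eq_expCoeff, expCoeff_zero]

/-! ### Isospectral evolution -/

/-- The coefficient of `exp (-2ξ)` in the profile on `(x_j, x_{j+1})`. -/
noncomputable def headSum (x m : ℕ → ℝ) (j : ℕ) : ℝ :=
  (1 / 2) * ∑ i ∈ Finset.Ioc 0 j, m i * Real.exp (2 * x i)

/-- The coefficient of `exp (2ξ)` in the profile on `(x_j, x_{j+1})`. -/
noncomputable def tailSum (n : ℕ) (x m : ℕ → ℝ) (j : ℕ) : ℝ :=
  (1 / 2) * ∑ i ∈ Finset.Ioc j n, m i * Real.exp (-2 * x i)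

theorem headSum_succ (x m : ℕ → ℝ) (j : ℕ) :
    headSum x m (j + 1) = headSum x m j + (1 / 2) * (m (j + 1) * Real.exp (2 * x (j + 1))) := by
  simp only [headSum]
  rw [Finset.sum_Ioc_succ_top (Nat.zero_le _), mul_add]

theorem tailSum_eq_add (n : ℕ) (x m : ℕ → ℝ) (j : ℕ) (hj : j < n) :
    tailSum n x m j = (1 / 2) * (m (j + 1) * Real.exp (-2 * x (j + 1))) +
      tailSum n x m (j + 1) := by
  simp only [tailSum]
  rw [← Finset.sum_Ioc_consecutive _ (Nat.le_succ j) hj, mul_add]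
  simp

theorem tailSum_self (n : ℕ) (x m : ℕ → ℝ) : tailSum n x m n = 0 := by simp [tailSum]

theorem sum_Icc_eq_add (F : ℕ → ℝ) {n j : ℕ} (hj : j < n) :
    ∑ i ∈ Finset.Icc 1 n, F i =
      ∑ i ∈ Finset.Ioc 0 j, F i + F (j + 1) + ∑ i ∈ Finset.Ioc (j + 1) n, F i := by
  have : Finset.Icc 1 n = Finset.Ioc 0 n := by ext; simp [Nat.succ_le_iff]
  rw [this, ← Finset.sum_Ioc_consecutive _ (Nat.zero_le (j + 1)) hj,
    Finset.sum_Ioc_succ_top (Nat.zero_le _)]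

theorem profile_eq {n : ℕ} {x m : ℕ → ℝ} (hx : StrictMonoOn x (Set.Icc 1 n)) {j : ℕ} (hj : j < n) :
    profile n x m (x (j + 1)) = headSum x m j * Real.exp (-2 * x (j + 1)) + (1 / 2) * m (j + 1) +
      tailSum n x m (j + 1) * Real.exp (2 * x (j + 1)) := by
  rw [profile, sum_Icc_eq_add _ hj, headSum, tailSum, mul_assoc, mul_assoc, Finset.sum_mul,
    Finset.sum_mul, mul_add, mul_add]
  congr 1
  · congr 1
    · congr 1
      refine Finset.sum_congr rfl fun i hi => ?_
      rw [Finset.mem_Ioc] at hi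
      have := hx ⟨by omega, by omega⟩ ⟨by omega, by omega⟩ (show i < j + 1 by omega)
      rw [abs_of_pos (by linarith), mul_assoc, ← Real.exp_add]
      ring_nf
    · simp
  · congr 1
    refine Finset.sum_congr rfl fun i hi => ?_
    rw [Finset.mem_Ioc] at hi
    have := hx ⟨by omega, by omega⟩ ⟨by omega, by omega⟩ (show j + 1 < i by omega)
    rw [abs_of_neg (by linarith), mul_assoc, ← Real.exp_add]
    ring_nf

theorem profileSlope_eq {n : ℕ} {x m : ℕ → ℝ} (hx : StrictMonoOn x (Set.Icc 1 n)) {j : ℕ}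
    (hj : j < n) :
    profileSlope n x m (x (j + 1)) = -2 * headSum x m j * Real.exp (-2 * x (j + 1)) +
      2 * tailSum n x m (j + 1) * Real.exp (2 * x (j + 1)) := by
  have h1 : ∑ i ∈ Finset.Ioc 0 j, m i * Real.sign (x (j + 1) - x i) *
      Real.exp (-2 * |x (j + 1) - x i|) =
      (∑ i ∈ Finset.Ioc 0 j, m i * Real.exp (2 * x i)) * Real.exp (-2 * x (j + 1)) := by
    rw [Finset.sum_mul]
    refine Finset.sum_congr rfl fun i hi => ?_
    rw [Finset.mem_Ioc] at hi
    have := hx ⟨by omega, by omega⟩ ⟨by omega, by omega⟩ (show i < j + 1 by omega)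
    rw [abs_of_pos (by linarith), Real.sign_of_pos (by linarith), mul_assoc, mul_assoc,
      ← Real.exp_add]
    ring_nf
  have h2 : ∑ i ∈ Finset.Ioc (j + 1) n, m i * Real.sign (x (j + 1) - x i) *
      Real.exp (-2 * |x (j + 1) - x i|) =
      -(∑ i ∈ Finset.Ioc (j + 1) n, m i * Real.exp (-2 * x i)) * Real.exp (2 * x (j + 1)) := by
    rw [neg_mul, Finset.sum_mul, ← Finset.sum_neg_distrib]
    refine Finset.sum_congr rfl fun i hi => ?_
    rw [Finset.mem_Ioc] at hi
    have := hx ⟨by omega, by omega⟩ ⟨by omega, by omega⟩ (show j + 1 < i by omega)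
    rw [abs_of_neg (by linarith), Real.sign_of_neg (by linarith), mul_assoc, mul_assoc,
      ← Real.exp_add]
    ring_nf
  rw [profileSlope, sum_Icc_eq_add _ hj, h1, h2, headSum, tailSum]
  simp
  ring

/-- The Lax equation for the wave function. -/
theorem hasDerivAt_expCoeff {n : ℕ} {x m : ℝ → ℕ → ℝ} {t z : ℝ} (hz : z ≠ 0)
    (hx : StrictMonoOn (x t) (Set.Icc 1 n))
    (hx' : ∀ j ∈ Set.Icc 1 n, HasDerivAt (fun s => x s j) (profile n (x t) (m t) (x t j)) t)
    (hm' : ∀ j ∈ Set.Icc 1 n,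
      HasDerivAt (fun s => m s j) (-profileSlope n (x t) (m t) (x t j) * m t j) t)
    (j : ℕ) (hj : j ≤ n) :
    HasDerivAt (fun s => (expCoeff (x s) (m s) z j).1)
      (2 * tailSum n (x t) (m t) j * (expCoeff (x t) (m t) z j).2) t ∧
    HasDerivAt (fun s => (expCoeff (x s) (m s) z j).2)
      (-(2 / z) * (expCoeff (x t) (m t) z j).2 -
        2 * headSum (x t) (m t) j * (expCoeff (x t) (m t) z j).1) t := by
  induction j with
  | zero => simp [expCoeff, headSum, hasDerivAt_const]
  | succ j ih =>
    obtain ⟨hA, hB⟩ := ih (by omega)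
    have hX := hx' (j + 1) ⟨by omega, hj⟩
    have hM := hm' (j + 1) ⟨by omega, hj⟩
    rw [profile_eq hx hj] at hX
    rw [profileSlope_eq hx hj] at hM
    rw [tailSum_eq_add n _ _ j hj] at hA
    have hE := (hX.const_mul 2).exp
    have hE' := (hX.const_mul (-2)).exp
    have hexp : Real.exp (-2 * x t (j + 1)) = (Real.exp (2 * x t (j + 1)))⁻¹ := by
      rw [← Real.exp_neg]; ring_nf
    have hpos := Real.exp_pos (2 * x t (j + 1))
    have hzm := (hM.const_mul z).div_const 2
    simp only [expCoeff, headSum_succ]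
    constructor
    · refine (hA.fun_add (hzm.fun_mul (hA.fun_add (hB.fun_mul hE')))).congr_deriv ?_
      simp only [hexp]
      generalize Real.exp (2 * x t (j + 1)) = e at hpos
      field_simp
      ring
    · refine (hB.fun_sub (hzm.fun_mul ((hA.fun_mul hE).fun_add hB))).congr_deriv ?_
      simp only [hexp]
      generalize Real.exp (2 * x t (j + 1)) = e at hpos
      field_simp
      ring

/-- The scattering data, expressed by values of the wave function at the eigenvalues. -/
def IsSpectralData (n : ℕ) (x m : ℕ → ℝ) (lam a : Fin n → ℝ) : Prop :=
  (∀ j, waveEnd n x m (lam j) = 0) ∧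
    ∀ j, waveEndSlope n x m (lam j) * ∏ i, -lam i =
      2 * (a j * (lam j * ∏ i ∈ Finset.univ.erase j, (lam j - lam i)))

section

variable {n : ℕ} {x m : ℕ → ℝ} {lam a : Fin n → ℝ}

theorem eval_wavePoly_fst (z : ℝ) :
    (wavePoly (stringL n x) (stringG n x m) (n + 1)).1.eval z = waveEnd n x m z := by
  simp [waveEnd, wave_eq_eval]

theorem eval_wavePoly_snd (z : ℝ) :
    (wavePoly (stringL n x) (stringG n x m) n).2.eval z = waveEndSlope n x m z := by
  simp [waveEndSlope, wave_eq_eval]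

theorem waveEnd_eq_prod (hlam : Function.Injective lam) (h : ∀ j, waveEnd n x m (lam j) = 0)
    (z : ℝ) : waveEnd n x m z =
      (wavePoly (stringL n x) (stringG n x m) (n + 1)).1.coeff n * ∏ i, (z - lam i) := by
  set Φ := (wavePoly (stringL n x) (stringG n x m) (n + 1)).1 with hΦ
  have hΦc := (coeff_wavePoly_eq_zero (stringL n x) (stringG n x m) (n + 1)).1
  rw [← hΦ] at hΦc
  let N : Polynomial ℝ := Lagrange.nodal Finset.univ lam
  have hNdeg : N.natDegree = n := by simp [N]
  have hNm : N.Monic := Lagrange.nodal_monic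
  have key : Φ - Polynomial.C (Φ.coeff n) * N = 0 := by
    refine Polynomial.eq_zero_of_degree_lt_of_eval_index_eq_zero (s := Finset.univ) (v := lam)
      hlam.injOn ?_ ?_
    · rw [Finset.card_univ, Fintype.card_fin, Polynomial.degree_lt_iff_coeff_zero]
      intro i hi
      rw [Polynomial.coeff_sub, Polynomial.coeff_C_mul]
      rcases hi.eq_or_lt with rfl | hi
      · have : N.coeff n = 1 := by
          have := hNm.coeff_natDegree
          rwa [hNdeg] at this
        rw [this]; ring
      · rw [hΦc i hi, Polynomial.coeff_eq_zero_of_natDegree_lt (hNdeg.trans_lt hi)]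
        ring
    · intro i hi
      rw [Polynomial.eval_sub, Polynomial.eval_mul, hΦ, eval_wavePoly_fst, h,
        Lagrange.eval_nodal_at_node hi]
      ring
  have := congrArg (Polynomial.eval z) (sub_eq_zero.1 key)
  rw [hΦ, eval_wavePoly_fst] at this
  rw [this]
  simp [N, hΦ, Lagrange.eval_nodal]

/-- Multiplied by zφ(1, z), the partial fraction expansion becomes a polynomial identity. It holds
off a finite set, hence everywhere, and at z = λ_j a single term survives. Values at the eigenvalues
are what the evolution equations control. -/
theorem HasScatteringData.isSpectralData (hlam : Function.Injective lam)
    (h : HasScatteringData n x m lam a) : IsSpectralData n x m lam a := by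
  have h0 : ∀ j, waveEnd n x m (lam j) = 0 := fun j => (h.1 _).2 ⟨j, rfl⟩
  refine ⟨h0, fun j => ?_⟩
  have hprod := waveEnd_eq_prod hlam h0
  set c := (wavePoly (stringL n x) (stringG n x m) (n + 1)).1.coeff n
  have hc : 2 = c * ∏ i, -lam i := by
    have := hprod 0
    simpa [waveEnd_zero] using this
  let T : Polynomial ℝ := Polynomial.C (c / 2) * ∏ i, (Polynomial.X - Polynomial.C (lam i)) +
    ∑ j, Polynomial.C (c * a j) * (Polynomial.X *
      ∏ i ∈ Finset.univ.erase j, (Polynomial.X - Polynomial.C (lam i)))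
  have hT : ∀ z, T.eval z = c / 2 * ∏ i, (z - lam i) +
      ∑ j, c * a j * (z * ∏ i ∈ Finset.univ.erase j, (z - lam i)) := by
    intro z
    simp [T, Polynomial.eval_finsetSum, Polynomial.eval_prod]
  have hST : (wavePoly (stringL n x) (stringG n x m) n).2 = T := by
    refine Polynomial.eq_of_infinite_eval_eq _ _ (Set.Infinite.mono (s := (insert 0 (Set.range lam))ᶜ)
      ?_ (Set.Finite.infinite_compl ((Set.finite_range lam).insert 0)))
    intro z hz
    simp only [Set.mem_compl_iff, Set.mem_insert_iff, Set.mem_range, not_or] at hz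
    obtain ⟨hz0, hz1⟩ := hz
    have hzl : ∀ i, z - lam i ≠ 0 := fun i hi => hz1 ⟨i, (sub_eq_zero.1 hi).symm⟩
    have hend : waveEnd n x m z ≠ 0 := fun h' => hz1 ((h.1 z).1 h')
    have hw := h.2 z hz0 (fun j hj => hz1 ⟨j, hj⟩)
    rw [Set.mem_ofPred_eq, eval_wavePoly_snd, hT]
    rw [weyl, div_div, div_eq_iff (mul_ne_zero hend hz0)] at hw
    rw [hw, hprod, add_mul, Finset.sum_mul]
    congr 1
    · field_simp
    · refine Finset.sum_congr rfl fun i _ => ?_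
      rw [← Finset.mul_prod_erase _ _ (Finset.mem_univ i)]
      have := hzl i
      field_simp
  rw [← eval_wavePoly_snd, hST, hT, Finset.prod_eq_zero (Finset.mem_univ j) (sub_self _),
    Finset.sum_eq_single j]
  · rw [mul_zero, zero_add, ← mul_right_inj' (two_ne_zero (α := ℝ))]
    linear_combination (-2 * a j * lam j * ∏ i ∈ Finset.univ.erase j, (lam j - lam i)) * hc
  · intro i _ hij
    rw [Finset.prod_eq_zero (Finset.mem_erase.2 ⟨hij.symm, Finset.mem_univ j⟩) (sub_self _)]
    ring
  · simp

end

theorem eq_of_hasDerivAt_zero {f : ℝ → ℝ} {s t : ℝ} (h : ∀ r ∈ Set.uIcc s t, HasDerivAt f 0 r) :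
    f t = f s := by
  rcases eq_or_ne s t with rfl | hst
  · rfl
  refine (convex_uIcc s t).is_const_of_fderivWithin_eq_zero (𝕜 := ℝ)
    (fun r hr => (h r hr).differentiableAt.differentiableWithinAt) (fun r hr => ?_)
    Set.right_mem_uIcc Set.left_mem_uIcc
  have hu : UniqueDiffWithinAt ℝ (Set.uIcc s t) r :=
    uniqueDiffOn_Icc (by simpa using hst.symm) r hr
  rw [fderivWithin_eq_fderiv hu (h r hr).differentiableAt]
  ext
  simp [(h r hr).deriv]

namespace IsMultipeakon

variable {n : ℕ} {lam a : Fin n → ℝ} {x m : ℝ → ℕ → ℝ}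

/-- The scattering data of a multipeakon evolve linearly. -/
theorem isSpectralData (hxm : IsMultipeakon n lam a x m)
    (hlam : Function.Injective lam) (hlam0 : ∀ j, lam j ≠ 0) {t : ℝ}
    (ht : IsRegularTime lam a t) : IsSpectralData n (x t) (m t) lam (residue lam a t) := by
  obtain ⟨s, hs, hdata⟩ := hxm.scattering t ht
  have h := hdata.isSpectralData hlam
  have hder : ∀ j, ∀ r ∈ Set.uIcc s t, _ := fun j r hr =>
    hasDerivAt_expCoeff (hlam0 j) (hxm.ordered r (hs r hr))
      (hxm.hasDerivAt_position r (hs r hr)) (hxm.hasDerivAt_weight r (hs r hr)) n le_rfl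
  simp only [tailSum_self, mul_zero, zero_mul] at hder
  -- Nothing lies to the right of x_n, so the Lax equation makes the last A constant: eigenvalues
  -- persist.
  have hA : ∀ j, ∀ r ∈ Set.uIcc s t, (expCoeff (x r) (m r) (lam j) n).1 = 0 := by
    intro j r hr
    have h1 : (expCoeff (x r) (m r) (lam j) n).1 = (expCoeff (x s) (m s) (lam j) n).1 :=
      eq_of_hasDerivAt_zero (f := fun r => (expCoeff (x r) (m r) (lam j) n).1) fun q hq =>
        (hder j q (Set.uIcc_subset_uIcc_left hr hq)).1
    have h2 := h.1 j
    rw [waveEnd_eq_expCoeff] at h2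
    rw [h1]; linarith
  refine ⟨fun j => by rw [waveEnd_eq_expCoeff, hA j t Set.right_mem_uIcc, mul_zero], fun j => ?_⟩
  have h2 := h.2 j
  rw [waveEndSlope_eq_expCoeff, hA j s Set.left_mem_uIcc] at h2
  rw [waveEndSlope_eq_expCoeff, hA j t Set.right_mem_uIcc]
  -- With A = 0 the equation for B reduces to B' = -(2/λ_j) B, so this product is conserved.
  have hB := eq_of_hasDerivAt_zero (s := s) (t := t)
    (f := fun r => (expCoeff (x r) (m r) (lam j) n).2 * Real.exp (2 * r / lam j)) fun q hq => by
      have h3 := (hder j q hq).2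
      rw [hA j q hq, mul_zero, sub_zero] at h3
      refine (h3.fun_mul (((hasDerivAt_id q).const_mul 2).div_const (lam j)).exp).congr_deriv ?_
      simp only [id]
      ring
  simp only [residue] at h2 ⊢
  have e1 : ∀ r, Real.exp (2 * r / lam j) * Real.exp (-2 * r / lam j) = 1 := by
    intro r
    rw [← Real.exp_add]
    simp [← add_div]
  have e2 := e1 s
  have e3 := e1 t
  set Bt := (expCoeff (x t) (m t) (lam j) n).2
  set Bs := (expCoeff (x s) (m s) (lam j) n).2
  have hBt : Bt = Bs * Real.exp (2 * s / lam j) * Real.exp (-2 * t / lam j) := by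
    linear_combination Real.exp (-2 * t / lam j) * hB - Bt * e3
  rw [hBt]
  linear_combination (Real.exp (2 * s / lam j) * Real.exp (-2 * t / lam j)) * h2 +
    (2 * a j * lam j * (∏ i ∈ Finset.univ.erase j, (lam j - lam i)) *
      Real.exp (-2 * t / lam j)) * e2

end IsMultipeakon

/-! ### Explicit positions and weights -/

/-- The moments without the contribution of the atom at `0`. -/
noncomputable def tailMoment {n : ℕ} (lam a : Fin n → ℝ) (k : ℕ) : ℝ :=
  ∑ j, a j * (-lam j) ^ k

/-- Hankel determinants of the moments without the atom at `0`. -/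
noncomputable def tailHankel {n : ℕ} (lam a : Fin n → ℝ) (l k : ℕ) : ℝ :=
  hankelDet (tailMoment lam a) l k

section

variable {n : ℕ} {lam a : Fin n → ℝ}

@[simp] theorem tailHankel_zero (l : ℕ) : tailHankel lam a l 0 = 1 := hankelDet_zero _ _

theorem moment_succ (k : ℕ) : moment lam a (k + 1) = tailMoment lam a (k + 1) := by
  simp [moment, tailMoment, mul_comm]

theorem hankelDet_moment_succ (l k : ℕ) :
    hankelDet (moment lam a) (l + 1) k = tailHankel lam a (l + 1) k :=
  hankelDet_congr (fun i => by rw [add_right_comm, moment_succ]) k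

theorem hankelDet_moment_zero (k : ℕ) : hankelDet (moment lam a) 0 (k + 1) =
    tailHankel lam a 0 (k + 1) + 1 / 2 * tailHankel lam a 2 k :=
  hankelDet_eq_add _ _ _ (by simp [moment, tailMoment, mul_comm, add_comm]) moment_succ k

theorem tailHankel_zero_pos (hlam : Function.Injective lam) (ha : ∀ j, 0 < a j) {k : ℕ}
    (hk : k ≤ n) : 0 < tailHankel lam a 0 k :=
  hankelDet_pos a (fun j => -lam j) ha (neg_injective.comp hlam)
    (fun i => by simp [tailMoment]) (by simpa using hk)

theorem tailHankel_two_pos (hlam : Function.Injective lam) (hlam0 : ∀ j, lam j ≠ 0)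
    (ha : ∀ j, 0 < a j) {k : ℕ} (hk : k ≤ n) : 0 < tailHankel lam a 2 k :=
  hankelDet_pos (fun j => a j * lam j ^ 2) (fun j => -lam j)
    (fun j => mul_pos (ha j) (by have := hlam0 j; positivity)) (neg_injective.comp hlam)
    (fun i => Finset.sum_congr rfl fun j _ => by rw [pow_add, neg_sq, mul_assoc])
    (by simpa using hk)

/-- The weights -λ_j a_j may have either sign, so positivity is lost; at full size the determinant
is still their product times a squared Vandermonde determinant. This excludes collisions with index
0. -/
theorem tailHankel_one_self_ne_zero (hlam : Function.Injective lam) (hlam0 : ∀ j, lam j ≠ 0)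
    (ha : ∀ j, 0 < a j) : tailHankel lam a 1 n ≠ 0 :=
  hankelDet_ne_zero (fun j => a j * -lam j) (fun j => -lam j)
    (fun j => mul_ne_zero (ha j).ne' (neg_ne_zero.2 (hlam0 j))) (neg_injective.comp hlam)
    (fun i => Finset.sum_congr rfl fun j _ => by rw [pow_add, pow_one, mul_assoc])

theorem hankelDet_moment_zero_pos (hlam : Function.Injective lam) (hlam0 : ∀ j, lam j ≠ 0)
    (ha : ∀ j, 0 < a j) {k : ℕ} (hk : k ≤ n) : 0 < hankelDet (moment lam a) 0 k := by
  cases k with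
  | zero => simp
  | succ k =>
    have h1 := tailHankel_zero_pos hlam ha hk
    have h2 := tailHankel_two_pos hlam hlam0 ha (show k ≤ n by omega)
    rw [hankelDet_moment_zero]
    positivity

theorem prod_erase_eq {ι : Type*} [Fintype ι] [DecidableEq ι] (f : ι → ℝ) (j : ι) :
    ∏ i ∈ Finset.univ.erase j, f i = ∏ i, if i = j then 1 else f i := by
  rw [← Finset.mul_prod_erase _ _ (Finset.mem_univ j), if_pos rfl, one_mul]
  exact Finset.prod_congr rfl fun i hi => by rw [if_neg (Finset.ne_of_mem_erase hi)]

variable {x m : ℕ → ℝ}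

/-- The lengths and masses of the string in terms of the scattering data. -/
theorem IsSpectralData.string_eq (h : IsSpectralData n x m lam a)
    (hlam : Function.Injective lam) (hlam0 : ∀ j, lam j ≠ 0) (ha : ∀ j, 0 < a j)
    (hx : StrictMonoOn x (Set.Icc 1 n)) (hm : ∀ j ∈ Set.Icc 1 n, m j ≠ 0) (k d : ℕ)
    (hn : n = k + (d + 1)) :
    stringL n x (d + 1) * (hankelDet (moment lam a) 0 k * hankelDet (moment lam a) 0 (k + 1)) =
      tailHankel lam a 1 k ^ 2 ∧
    stringG n x m (d + 1) * (tailHankel lam a 1 (k + 1) * tailHankel lam a 1 k) =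
      hankelDet (moment lam a) 0 (k + 1) ^ 2 := by
  have hprod := waveEnd_eq_prod hlam h.1
  set c := (wavePoly (stringL n x) (stringG n x m) (n + 1)).1.coeff n with hc_def
  have hc : 2 = c * ∏ i, -lam i := by
    have := hprod 0
    simpa [waveEnd_zero] using this
  have hP : ∏ i, -lam i ≠ 0 := Finset.prod_ne_zero_iff.2 fun i _ => neg_ne_zero.2 (hlam0 i)
  have hyt : ∀ j ∈ Set.Icc 1 n, stringY n x j = Real.tanh (x j) := fun j hj => by
    rw [stringY, if_neg (by have := hj.1; omega), if_pos hj.2]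
  -- The term 1/(2z) of the Weyl expansion enters as one more node 0 with residue 1/2.
  have key := string_eq_hankelDet n (stringL n x) (stringG n x m) (Fin.cons 0 lam)
    (Fin.cons (1 / 2) a)
    (Fin.cons_injective_iff.2 ⟨fun ⟨j, hj⟩ => hlam0 j hj, hlam⟩)
    (fun j hj => by
      rw [stringL]
      refine sub_ne_zero.2 (ne_of_gt ?_)
      rcases Nat.eq_zero_or_pos j with rfl | hj0
      · rw [zero_add]
        rcases Nat.eq_zero_or_pos n with rfl | hn0
        · simp [stringY]
        · rw [hyt 1 ⟨le_rfl, hn0⟩, stringY, if_pos rfl]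
          exact Real.neg_one_lt_tanh _
      · rw [hyt j ⟨hj0, hj⟩]
        rcases hj.eq_or_lt with rfl | hjn
        · simp only [stringY, Nat.succ_ne_zero, if_false]
          rw [if_neg (by omega)]
          exact Real.tanh_lt_one _
        · rw [hyt (j + 1) ⟨by omega, hjn⟩]
          rw [← Real.artanh_lt_artanh_iff ⟨Real.neg_one_lt_tanh _, Real.tanh_lt_one _⟩
            ⟨Real.neg_one_lt_tanh _, Real.tanh_lt_one _⟩, Real.artanh_tanh, Real.artanh_tanh]
          exact hx ⟨hj0, hj⟩ ⟨by omega, hjn⟩ (Nat.lt_succ_self j))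
    (fun j hj => by
      rw [stringG, hyt (j + 1) ⟨by omega, hj⟩]
      have h1 := one_sub_tanh_pos (x (j + 1))
      have h2 := one_add_tanh_pos (x (j + 1))
      refine div_ne_zero (hm _ ⟨by omega, hj⟩) ?_
      rw [show 1 - Real.tanh (x (j + 1)) ^ 2 =
        (1 - Real.tanh (x (j + 1))) * (1 + Real.tanh (x (j + 1))) by ring]
      positivity)
    (fun j => by
      rw [eval_wavePoly_fst]
      cases j using Fin.cases with
      | zero => simp
      | succ j => simp [h.1 j])
    (fun j => by
      rw [eval_wavePoly_snd, ← hc_def, prod_erase_eq, Fin.prod_univ_succ]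
      cases j using Fin.cases with
      | zero =>
        simp only [Fin.cons_zero, waveEndSlope_zero, if_true, one_mul, Fin.succ_ne_zero, if_false,
          Fin.cons_succ, zero_sub]
        linear_combination hc / 2
      | succ j =>
        simp only [Fin.cons_zero, Fin.cons_succ, if_neg (Fin.succ_ne_zero j).symm, sub_zero,
          Fin.succ_inj]
        rw [← prod_erase_eq (fun i => lam j - lam i), ← mul_left_inj' hP, h.2 j]
        linear_combination (a j * lam j * ∏ i ∈ Finset.univ.erase j, (lam j - lam i)) * hc)
    (moment lam a) (fun i => by
      rw [Fin.sum_univ_succ]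
      simp [moment, mul_comm])
    (fun i hi => (hankelDet_moment_zero_pos hlam hlam0 ha hi).ne') k (d + 1) hn
  simp only [hankelDet_moment_succ] at key
  exact ⟨key.1, key.2 d rfl⟩

/-- Desnanot–Jacobi divided through: Stieltjes' formula for the lengths becomes a telescoping
difference. -/
theorem hankelDet_moment_sub (k : ℕ) (h0 : hankelDet (moment lam a) 0 (k + 1) ≠ 0)
    (h1 : hankelDet (moment lam a) 0 (k + 2) ≠ 0) :
    tailHankel lam a 2 (k + 1) / hankelDet (moment lam a) 0 (k + 2) -
      tailHankel lam a 2 k / hankelDet (moment lam a) 0 (k + 1) =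
    tailHankel lam a 1 (k + 1) ^ 2 /
      (hankelDet (moment lam a) 0 (k + 1) * hankelDet (moment lam a) 0 (k + 2)) := by
  have := hankelDet_desnanot (moment lam a) 0 k
  simp only [hankelDet_moment_succ] at this
  rw [one_add_one_eq_two] at this
  field_simp
  linear_combination -this

/-- Sum the lengths leftwards from y = 1; the sum telescopes. -/
theorem IsSpectralData.tanh_eq (h : IsSpectralData n x m lam a)
    (hlam : Function.Injective lam) (hlam0 : ∀ j, lam j ≠ 0) (ha : ∀ j, 0 < a j)
    (hx : StrictMonoOn x (Set.Icc 1 n)) (hm : ∀ j ∈ Set.Icc 1 n, m j ≠ 0) (k d : ℕ)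
    (hn : n = k + (d + 1)) :
    Real.tanh (x (d + 1)) = 1 - tailHankel lam a 2 k / hankelDet (moment lam a) 0 (k + 1) := by
  have hpos := fun {i : ℕ} (hi : i ≤ n) => hankelDet_moment_zero_pos hlam hlam0 ha hi
  have key : stringY n x (d + 1) =
      1 - tailHankel lam a 2 k / hankelDet (moment lam a) 0 (k + 1) := by
    induction k generalizing d with
    | zero =>
      have h1 := (h.string_eq hlam hlam0 ha hx hm 0 d hn).1
      rw [stringL, show stringY n x (d + 1 + 1) = 1 by
        rw [stringY, if_neg (by omega), if_neg (by omega)]] at h1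
      simp only [hankelDet_zero, tailHankel_zero, zero_add, one_mul, one_pow] at h1 ⊢
      have := hpos (show 1 ≤ n by omega)
      field_simp
      linarith
    | succ k ih =>
      have h1 := (h.string_eq hlam hlam0 ha hx hm (k + 1) d hn).1
      have h2 := ih (d + 1) (by omega)
      have p1 := (hpos (show k + 1 ≤ n by omega)).ne'
      have p2 := (hpos (show k + 2 ≤ n by omega)).ne'
      have h3 := hankelDet_moment_sub k p1 p2
      rw [stringL, h2, ← eq_div_iff (mul_ne_zero p1 p2), ← h3] at h1
      linarith
  rw [← key, stringY, if_neg (by omega), if_pos (by omega)]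

/-- The position of the peak with index `n - k` in terms of the scattering data. -/
noncomputable def peakPos {n : ℕ} (lam a : Fin n → ℝ) (k : ℕ) : ℝ :=
  Real.artanh (1 - tailHankel lam a 2 k / hankelDet (moment lam a) 0 (k + 1))

theorem IsSpectralData.position_eq (h : IsSpectralData n x m lam a)
    (hlam : Function.Injective lam) (hlam0 : ∀ j, lam j ≠ 0) (ha : ∀ j, 0 < a j)
    (hx : StrictMonoOn x (Set.Icc 1 n)) (hm : ∀ j ∈ Set.Icc 1 n, m j ≠ 0) (k d : ℕ)
    (hn : n = k + (d + 1)) : x (d + 1) = peakPos lam a k := by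
  rw [peakPos, ← h.tanh_eq hlam hlam0 ha hx hm k d hn, Real.artanh_tanh]

/-- Since D_{k+1} = T^0_{k+1} + T^2_k / 2, both factors 1 ± tanh x have a single determinant over
D_{k+1}; so D_{k+1}^2 cancels against Stieltjes' mass. -/
theorem IsSpectralData.weight_eq (h : IsSpectralData n x m lam a)
    (hlam : Function.Injective lam) (hlam0 : ∀ j, lam j ≠ 0) (ha : ∀ j, 0 < a j)
    (hx : StrictMonoOn x (Set.Icc 1 n)) (hm : ∀ j ∈ Set.Icc 1 n, m j ≠ 0) (k d : ℕ)
    (hn : n = k + (d + 1)) :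
    m (d + 1) * (tailHankel lam a 1 (k + 1) * tailHankel lam a 1 k) =
      2 * tailHankel lam a 0 (k + 1) * tailHankel lam a 2 k := by
  have h1 := (h.string_eq hlam hlam0 ha hx hm k d hn).2
  have h2 := h.tanh_eq hlam hlam0 ha hx hm k d hn
  have p := hankelDet_moment_zero_pos hlam hlam0 ha (show k + 1 ≤ n by omega)
  have p0 := tailHankel_zero_pos hlam ha (show k + 1 ≤ n by omega)
  have p2 := tailHankel_two_pos hlam hlam0 ha (show k ≤ n by omega)
  have h3 := hankelDet_moment_zero (lam := lam) (a := a) k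
  set D := hankelDet (moment lam a) 0 (k + 1)
  rw [stringG, stringY, if_neg (by omega), if_pos (by omega)] at h1
  have e : 1 - Real.tanh (x (d + 1)) ^ 2 =
      2 * tailHankel lam a 0 (k + 1) * tailHankel lam a 2 k / D ^ 2 := by
    rw [h2]
    field_simp
    rw [h3]; ring
  rw [e] at h1
  field_simp at h1
  linarith

theorem peakPos_arg_mem (hlam : Function.Injective lam) (hlam0 : ∀ j, lam j ≠ 0)
    (ha : ∀ j, 0 < a j) {k : ℕ} (hk : k < n) :
    1 - tailHankel lam a 2 k / hankelDet (moment lam a) 0 (k + 1) ∈ Set.Ioo (-1) 1 := by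
  have p := hankelDet_moment_zero_pos hlam hlam0 ha (show k + 1 ≤ n by omega)
  have p0 := tailHankel_zero_pos hlam ha (show k + 1 ≤ n by omega)
  have p2 := tailHankel_two_pos hlam hlam0 ha (show k ≤ n by omega)
  have h3 := hankelDet_moment_zero (lam := lam) (a := a) k
  constructor
  · have : tailHankel lam a 2 k / hankelDet (moment lam a) 0 (k + 1) < 2 := by
      rw [div_lt_iff₀ p]; linarith
    linarith
  · have := div_pos p2 p
    linarith

/-- By `hankelDet_moment_sub` the arguments of artanh differ by a square over a positive number. No
regularity is assumed, so this also holds at collisions. -/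
theorem peakPos_succ_le (hlam : Function.Injective lam) (hlam0 : ∀ j, lam j ≠ 0)
    (ha : ∀ j, 0 < a j) {k : ℕ} (hk : k + 1 < n) :
    peakPos lam a (k + 1) ≤ peakPos lam a k ∧
    (peakPos lam a (k + 1) = peakPos lam a k ↔ tailHankel lam a 1 (k + 1) = 0) := by
  have p1 := hankelDet_moment_zero_pos hlam hlam0 ha (show k + 1 ≤ n by omega)
  have p2 := hankelDet_moment_zero_pos hlam hlam0 ha (show k + 2 ≤ n by omega)
  have m1 := peakPos_arg_mem hlam hlam0 ha (show k < n by omega)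
  have m2 := peakPos_arg_mem hlam hlam0 ha hk
  have h3 := hankelDet_moment_sub k p1.ne' p2.ne'
  constructor
  · refine (Real.artanh_le_artanh_iff m2 m1).2 ?_
    have : 0 ≤ tailHankel lam a 1 (k + 1) ^ 2 /
      (hankelDet (moment lam a) 0 (k + 1) * hankelDet (moment lam a) 0 (k + 2)) := by positivity
    linarith
  · rw [peakPos, peakPos, Real.artanh_injOn.eq_iff m2 m1, sub_right_inj, ← sub_eq_zero, h3]
    simp [p1.ne', p2.ne']

end

/-! ### Zeros of Δ^1 and the time dependence -/

section

variable {n : ℕ} {lam a : Fin n → ℝ}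

/-- Up to a factor, the time derivative of `Δ^1_{k+1}`. -/
noncomputable def hankelSlope {n : ℕ} (lam a : Fin n → ℝ) (k : ℕ) : ℝ :=
  ((Matrix.of fun i j : Fin (k + 1) => tailMoment lam a (1 + i + j)).updateCol 0
    (fun i => tailMoment lam a i)).det

/-- With Δ^1_{k+1} = 0 the determinant identities lose a term, and Δ^3_k couples what is left: Δ^1_k
Δ^3_k is a positive square, Δ^1_{k+2} Δ^3_k a negative one, and the slope is a positive multiple of
Δ^3_k. The last relation says that the singular parts of the two weights cancel. -/
theorem tailHankel_one_neighbours (hlam : Function.Injective lam) (hlam0 : ∀ j, lam j ≠ 0)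
    (ha : ∀ j, 0 < a j) {k : ℕ} (hk : k + 2 ≤ n) (h0 : tailHankel lam a 1 (k + 1) = 0) :
    0 < hankelSlope lam a k * tailHankel lam a 1 k ∧
    hankelSlope lam a k * tailHankel lam a 1 (k + 2) < 0 ∧
    tailHankel lam a 0 (k + 2) * tailHankel lam a 2 (k + 1) * tailHankel lam a 1 k +
      tailHankel lam a 0 (k + 1) * tailHankel lam a 2 k * tailHankel lam a 1 (k + 2) = 0 := by
  have p1 := tailHankel_zero_pos hlam ha hk
  have p2 := tailHankel_zero_pos hlam ha (show k + 1 ≤ n by omega)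
  have p3 := tailHankel_two_pos hlam hlam0 ha (show k + 1 ≤ n by omega)
  have p4 := tailHankel_two_pos hlam hlam0 ha (show k ≤ n by omega)
  have e1 : tailHankel lam a 1 (k + 2) * tailHankel lam a 3 k = -tailHankel lam a 2 (k + 1) ^ 2 := by
    have : tailHankel lam a 1 (k + 2) * tailHankel lam a 3 k =
      tailHankel lam a 1 (k + 1) * tailHankel lam a 3 (k + 1) - tailHankel lam a 2 (k + 1) ^ 2 :=
      hankelDet_desnanot (tailMoment lam a) 1 k
    rw [this, h0]; ring
  have e2 : tailHankel lam a 1 k * tailHankel lam a 3 k = tailHankel lam a 2 k ^ 2 := by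
    cases k with
    | zero => simp
    | succ k =>
      have : tailHankel lam a 1 (k + 2) * tailHankel lam a 3 k =
        tailHankel lam a 1 (k + 1) * tailHankel lam a 3 (k + 1) - tailHankel lam a 2 (k + 1) ^ 2 :=
        hankelDet_desnanot (tailMoment lam a) 1 k
      rw [h0] at this
      linarith
  have e3 : tailHankel lam a 2 (k + 1) * hankelSlope lam a k =
      tailHankel lam a 0 (k + 2) * tailHankel lam a 3 k :=
    hankelDet_mul_det_updateCol (tailMoment lam a) k h0
  have e4 : tailHankel lam a 0 (k + 2) * tailHankel lam a 2 k =
      tailHankel lam a 0 (k + 1) * tailHankel lam a 2 (k + 1) := by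
    have : tailHankel lam a 0 (k + 2) * tailHankel lam a 2 k =
      tailHankel lam a 0 (k + 1) * tailHankel lam a 2 (k + 1) - tailHankel lam a 1 (k + 1) ^ 2 :=
      hankelDet_desnanot (tailMoment lam a) 0 k
    rw [this, h0]; ring
  have e5 : tailHankel lam a 3 k ≠ 0 := by
    intro h
    rw [h, mul_zero] at e2
    nlinarith
  refine ⟨?_, ?_, ?_⟩
  · refine pos_of_mul_pos_right (a := tailHankel lam a 2 (k + 1)) ?_ p3.le
    rw [show tailHankel lam a 2 (k + 1) * (hankelSlope lam a k * tailHankel lam a 1 k) =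
      tailHankel lam a 0 (k + 2) * tailHankel lam a 2 k ^ 2 by
        linear_combination tailHankel lam a 1 k * e3 + tailHankel lam a 0 (k + 2) * e2]
    positivity
  · refine neg_of_mul_neg_right (a := tailHankel lam a 2 (k + 1)) ?_ p3.le
    rw [show tailHankel lam a 2 (k + 1) * (hankelSlope lam a k * tailHankel lam a 1 (k + 2)) =
      -(tailHankel lam a 0 (k + 2) * tailHankel lam a 2 (k + 1) ^ 2) by
        linear_combination tailHankel lam a 1 (k + 2) * e3 + tailHankel lam a 0 (k + 2) * e1]
    have : 0 < tailHankel lam a 0 (k + 2) * tailHankel lam a 2 (k + 1) ^ 2 := by positivity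
    linarith
  · refine (mul_eq_zero.1 (?_ : (tailHankel lam a 3 k * tailHankel lam a 2 k) * _ = 0)).resolve_left
      (mul_ne_zero e5 p4.ne')
    linear_combination tailHankel lam a 2 (k + 1) * tailHankel lam a 1 k * tailHankel lam a 3 k * e4
      + tailHankel lam a 0 (k + 1) * tailHankel lam a 2 (k + 1) ^ 2 * e2
      + tailHankel lam a 0 (k + 1) * tailHankel lam a 2 k ^ 2 * e1

theorem tailHankel_one_eq_zero (hlam : Function.Injective lam) (hlam0 : ∀ j, lam j ≠ 0)
    (ha : ∀ j, 0 < a j) {k : ℕ} (hk : k ≤ n) (h : tailHankel lam a 1 k = 0) :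
    ∃ i, k = i + 1 ∧ i + 2 ≤ n := by
  have h1 : k ≠ 0 := by rintro rfl; simp at h
  have h2 : k ≠ n := by rintro rfl; exact tailHankel_one_self_ne_zero hlam hlam0 ha h
  exact ⟨k - 1, by omega, by omega⟩

theorem residue_pos (ha : ∀ j, 0 < a j) (t : ℝ) (j : Fin n) : 0 < residue lam a t j :=
  mul_pos (ha j) (Real.exp_pos _)

theorem hankelOne_eq_tailHankel (k : ℕ) (t : ℝ) :
    hankelOne lam a k t = tailHankel lam (residue lam a t) 1 k :=
  hankelDet_moment_succ (lam := lam) (a := residue lam a t) 0 k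

theorem hasDerivAt_residue (t : ℝ) (j : Fin n) :
    HasDerivAt (fun s => residue lam a s j) (residue lam a t j * (-2 / lam j)) t := by
  unfold residue
  refine ((((hasDerivAt_id t).const_mul (-2)).div_const (lam j)).exp.const_mul (a j)).congr_deriv ?_
  simp only [id]
  ring

theorem differentiable_tailMoment (k : ℕ) :
    Differentiable ℝ fun s => tailMoment lam (residue lam a s) k := by
  unfold tailMoment
  exact Differentiable.fun_sum fun j _ t =>
    ((hasDerivAt_residue t j).mul_const _).differentiableAt

theorem differentiable_tailHankel (l k : ℕ) :
    Differentiable ℝ fun s => tailHankel lam (residue lam a s) l k :=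
  differentiable_hankelDet differentiable_tailMoment l k

/-- Each residue has logarithmic derivative -2/λ_j, so differentiating a moment lowers its index and
doubles it. The moment of index 0 that appears lacks the atom at 0, hence `tailMoment` in
`hankelSlope`. -/
theorem hasDerivAt_tailHankel_one (hlam0 : ∀ j, lam j ≠ 0) (t : ℝ) (k : ℕ) :
    HasDerivAt (fun s => tailHankel lam (residue lam a s) 1 (k + 1))
      (2 * hankelSlope lam (residue lam a t) k) t := by
  refine hasDerivAt_hankelDet_one (f := fun s => tailMoment lam (residue lam a s)) (fun i => ?_) k
  unfold tailMoment
  rw [Finset.mul_sum]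
  refine HasDerivAt.fun_sum fun j _ => ((hasDerivAt_residue t j).mul_const _).congr_deriv ?_
  have := hlam0 j
  field_simp
  ring

theorem differentiable_peakPos (hlam : Function.Injective lam) (hlam0 : ∀ j, lam j ≠ 0)
    (ha : ∀ j, 0 < a j) {k : ℕ} (hk : k < n) :
    Differentiable ℝ fun s => peakPos lam (residue lam a s) k := by
  have hmem := fun s => peakPos_arg_mem hlam hlam0 (residue_pos (lam := lam) ha s) hk
  have hD := fun s => hankelDet_moment_zero_pos hlam hlam0 (residue_pos (lam := lam) ha s)
    (show k + 1 ≤ n by omega)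
  simp only [peakPos, Real.artanh_eq_half_log (Set.Ioo_subset_Icc_self (hmem _))]
  have hd : Differentiable ℝ fun s => 1 - tailHankel lam (residue lam a s) 2 k /
      hankelDet (moment lam (residue lam a s)) 0 (k + 1) := by
    refine (differentiable_const _).sub ((differentiable_tailHankel 2 k).div ?_
      fun s => (hD s).ne')
    simp only [hankelDet_moment_zero]
    exact (differentiable_tailHankel 0 (k + 1)).add
      ((differentiable_const _).mul (differentiable_tailHankel 2 k))
  refine (differentiable_const _).mul (Differentiable.log (Differentiable.div
    ((differentiable_const _).add hd) ((differentiable_const _).sub hd) fun s => ?_) fun s => ?_)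
  · have := (hmem s).2
    intro h; linarith
  · have h1 := (hmem s).1
    have h2 := (hmem s).2
    exact div_ne_zero (by intro h; linarith) (by intro h; linarith)

end

/-! ### Elementary analysis -/

/-- L'Hôpital's rule at a simple zero of the denominator. -/
theorem tendsto_div_of_hasDerivAt {f g : ℝ → ℝ} {f' g' t : ℝ} (hf : HasDerivAt f f' t)
    (hg : HasDerivAt g g' t) (hf0 : f t = 0) (hg0 : g t = 0) (hg' : g' ≠ 0) :
    Tendsto (fun s => f s / g s) (𝓝[≠] t) (𝓝 (f' / g')) := by
  refine ((hasDerivAt_iff_tendsto_slope.1 hf).div (hasDerivAt_iff_tendsto_slope.1 hg)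
    hg').congr' ?_
  filter_upwards [self_mem_nhdsWithin] with s hs
  have : s - t ≠ 0 := sub_ne_zero.2 hs
  simp only [Pi.div_apply, slope_def_field, hf0, hg0, sub_zero]
  field_simp

theorem eventually_mul_slope_pos {g : ℝ → ℝ} {g' t : ℝ} (hg : HasDerivAt g g' t) (hg0 : g t = 0)
    (hg' : g' ≠ 0) : (∀ᶠ s in 𝓝[<] t, g s * g' < 0) ∧ ∀ᶠ s in 𝓝[>] t, 0 < g s * g' := by
  have h1 := (hasDerivAt_iff_tendsto_slope.1 hg).mul_const g'
  have h2 : ∀ᶠ s in 𝓝[≠] t, 0 < slope g t s * g' :=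
    h1.eventually_const_lt (mul_self_pos.2 hg')
  constructor
  · filter_upwards [h2.filter_mono (nhdsWithin_mono _ fun s hs => ne_of_lt hs),
      self_mem_nhdsWithin] with s hs hst
    rw [slope_def_field, hg0, sub_zero, div_mul_eq_mul_div] at hs
    have h3 : s - t < 0 := sub_neg.2 hst
    by_contra! h4
    exact absurd hs (not_lt.2 (div_nonpos_of_nonneg_of_nonpos h4 h3.le))
  · filter_upwards [h2.filter_mono (nhdsWithin_mono _ fun s hs => ne_of_gt hs),
      self_mem_nhdsWithin] with s hs hst
    rw [slope_def_field, hg0, sub_zero, div_mul_eq_mul_div] at hs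
    have h3 : 0 < s - t := sub_pos.2 hst
    exact (div_pos_iff_of_pos_right h3).1 hs

theorem abs_exp_sub_exp_le (ξ p q : ℝ) :
    |Real.exp (-2 * |ξ - p|) - Real.exp (-2 * |ξ - q|)| ≤ 2 * |p - q| := by
  have aux : ∀ u v : ℝ, 0 ≤ u → u ≤ v → |Real.exp (-2 * u) - Real.exp (-2 * v)| ≤ 2 * (v - u) := by
    intro u v hu huv
    have h1 : Real.exp (-2 * v) ≤ Real.exp (-2 * u) := Real.exp_le_exp.2 (by linarith)
    rw [abs_of_nonneg (by linarith)]
    have h2 : Real.exp (-2 * v) = Real.exp (-2 * u) * Real.exp (-2 * (v - u)) := by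
      rw [← Real.exp_add]; ring_nf
    have h3 := Real.add_one_le_exp (-2 * (v - u))
    have h4 : Real.exp (-2 * u) ≤ 1 := Real.exp_le_one_iff.2 (by linarith)
    have h5 := Real.exp_pos (-2 * u)
    rw [h2]
    nlinarith
  have h := abs_abs_sub_abs_le_abs_sub (ξ - p) (ξ - q)
  rw [show ξ - p - (ξ - q) = -(p - q) by ring, abs_neg] at h
  have h' := abs_le.1 h
  rcases le_total |ξ - p| |ξ - q| with hpq | hpq
  · have := aux _ _ (abs_nonneg _) hpq
    linarith
  · rw [abs_sub_comm]
    have := aux _ _ (abs_nonneg _) hpq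
    linarith

/-! ### The solution near a singular time -/

section

variable {n : ℕ} {lam a : Fin n → ℝ}

/-- Zeros of the finitely many Δ^1_k are simple, hence isolated. -/
theorem eventually_isRegularTime (hlam : Function.Injective lam) (hlam0 : ∀ j, lam j ≠ 0)
    (ha : ∀ j, 0 < a j) (t₀ : ℝ) : ∀ᶠ t in 𝓝[≠] t₀, IsRegularTime lam a t := by
  have h : ∀ k ∈ Set.Iic n, ∀ᶠ t in 𝓝[≠] t₀, hankelOne lam a k t ≠ 0 := by
    intro k hk
    simp only [hankelOne_eq_tailHankel]
    rcases eq_or_ne (tailHankel lam (residue lam a t₀) 1 k) 0 with h0 | h0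
    · obtain ⟨i, rfl, hi⟩ := tailHankel_one_eq_zero hlam hlam0 (residue_pos ha t₀) hk h0
      have h1 := tailHankel_one_neighbours hlam hlam0 (residue_pos ha t₀) hi h0
      have := (hasDerivAt_tailHankel_one (a := a) hlam0 t₀ i).eventually_ne (c := 0)
        (mul_ne_zero two_ne_zero (left_ne_zero_of_mul h1.1.ne'))
      exact this
    · exact ((differentiable_tailHankel 1 k).continuous.continuousAt.eventually_ne h0).filter_mono
        nhdsWithin_le_nhds
  exact (eventually_all_finite (Set.finite_Iic n)).2 h

variable {x m : ℝ → ℕ → ℝ}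

theorem IsMultipeakon.position_eq (hxm : IsMultipeakon n lam a x m)
    (hlam : Function.Injective lam) (hlam0 : ∀ j, lam j ≠ 0) (ha : ∀ j, 0 < a j) {t : ℝ}
    (ht : IsRegularTime lam a t) (k d : ℕ) (hn : n = k + (d + 1)) :
    x t (d + 1) = peakPos lam (residue lam a t) k :=
  (hxm.isSpectralData hlam hlam0 ht).position_eq hlam hlam0 (residue_pos ha t)
    (hxm.ordered t ht) (hxm.weight_ne_zero t ht) k d hn

theorem IsMultipeakon.weight_eq (hxm : IsMultipeakon n lam a x m)
    (hlam : Function.Injective lam) (hlam0 : ∀ j, lam j ≠ 0) (ha : ∀ j, 0 < a j) {t : ℝ}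
    (ht : IsRegularTime lam a t) (k d : ℕ) (hn : n = k + (d + 1)) :
    m t (d + 1) * (tailHankel lam (residue lam a t) 1 (k + 1) *
      tailHankel lam (residue lam a t) 1 k) =
    2 * tailHankel lam (residue lam a t) 0 (k + 1) * tailHankel lam (residue lam a t) 2 k :=
  (hxm.isSpectralData hlam hlam0 ht).weight_eq hlam hlam0 (residue_pos ha t)
    (hxm.ordered t ht) (hxm.weight_ne_zero t ht) k d hn

/-- At a collision a peakon on the left and an antipeakon on the right are interchanged. -/
theorem IsMultipeakon.sign_change (hxm : IsMultipeakon n lam a x m)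
    (hlam : Function.Injective lam) (hlam0 : ∀ j, lam j ≠ 0) (ha : ∀ j, 0 < a j) {t₀ : ℝ}
    {k d : ℕ} (hn : n = k + 1 + (d + 1))
    (h0 : tailHankel lam (residue lam a t₀) 1 (k + 1) = 0) :
    (∀ᶠ t in 𝓝[<] t₀, 0 < m t (d + 1) ∧ m t (d + 2) < 0) ∧
    (∀ᶠ t in 𝓝[>] t₀, m t (d + 1) < 0 ∧ 0 < m t (d + 2)) := by
  obtain ⟨h1, h2, -⟩ := tailHankel_one_neighbours hlam hlam0 (residue_pos ha t₀)
    (show k + 2 ≤ n by omega) h0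
  have hreg := eventually_isRegularTime hlam hlam0 ha t₀
  have hδ := hasDerivAt_tailHankel_one (a := a) hlam0 t₀ k
  set D := hankelSlope lam (residue lam a t₀) k
  have hD : 2 * D ≠ 0 := mul_ne_zero two_ne_zero (left_ne_zero_of_mul h1.ne')
  have hsgn := eventually_mul_slope_pos hδ h0 hD
  have hQ : ∀ᶠ t in 𝓝 t₀, 0 < D * tailHankel lam (residue lam a t) 1 k :=
    (((differentiable_tailHankel 1 k).continuous.tendsto t₀).const_mul D).eventually_const_lt h1
  have hP : ∀ᶠ t in 𝓝 t₀, D * tailHankel lam (residue lam a t) 1 (k + 2) < 0 :=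
    (((differentiable_tailHankel 1 (k + 2)).continuous.tendsto t₀).const_mul D).eventually_lt_const
      h2
  -- The weight formulas times 2D². The middle factors have known signs, and the last factor has the
  -- sign of t - t₀ because 2D is the derivative of Δ^1_{k+1}.
  have key : ∀ t, IsRegularTime lam a t → 0 < D * tailHankel lam (residue lam a t) 1 k →
      D * tailHankel lam (residue lam a t) 1 (k + 2) < 0 →
      0 < m t (d + 1) * (D * tailHankel lam (residue lam a t) 1 (k + 2)) *
        (tailHankel lam (residue lam a t) 1 (k + 1) * (2 * D)) ∧
      0 < m t (d + 2) * (D * tailHankel lam (residue lam a t) 1 k) *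
        (tailHankel lam (residue lam a t) 1 (k + 1) * (2 * D)) := by
    intro t ht hQ hP
    have e1 := hxm.weight_eq hlam hlam0 ha ht (k + 1) d hn
    have e2 := hxm.weight_eq hlam hlam0 ha ht k (d + 1) (by omega)
    have hD2 : 0 < D ^ 2 := by
      have := left_ne_zero_of_mul h1.ne'
      positivity
    have ha' := residue_pos (lam := lam) ha t
    have p1 := tailHankel_zero_pos hlam ha' (show k + 2 ≤ n by omega)
    have p2 := tailHankel_zero_pos hlam ha' (show k + 1 ≤ n by omega)
    have p3 := tailHankel_two_pos hlam hlam0 ha' (show k + 1 ≤ n by omega)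
    have p4 := tailHankel_two_pos hlam hlam0 ha' (show k ≤ n by omega)
    constructor
    · have : 0 < (2 * D ^ 2) * (2 * tailHankel lam (residue lam a t) 0 (k + 1 + 1) *
        tailHankel lam (residue lam a t) 2 (k + 1)) := by positivity
      rw [← e1] at this
      convert this using 1
      ring
    · have : 0 < (2 * D ^ 2) * (2 * tailHankel lam (residue lam a t) 0 (k + 1) *
        tailHankel lam (residue lam a t) 2 k) := by positivity
      rw [← e2] at this
      convert this using 1
      ring
  constructor
  · filter_upwards [hsgn.1, nhdsWithin_le_nhds hQ, nhdsWithin_le_nhds hP,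
      hreg.filter_mono (nhdsWithin_mono _ fun s hs => ne_of_lt hs)] with t g1 g2 g3 g4
    obtain ⟨f1, f2⟩ := key t g4 g2 g3
    have f1' := neg_of_mul_pos_left f1 g1.le
    have f2' := neg_of_mul_pos_left f2 g1.le
    exact ⟨pos_of_mul_neg_left f1' g3.le, neg_of_mul_neg_left f2' g2.le⟩
  · filter_upwards [hsgn.2, nhdsWithin_le_nhds hQ, nhdsWithin_le_nhds hP,
      hreg.filter_mono (nhdsWithin_mono _ fun s hs => ne_of_gt hs)] with t g1 g2 g3 g4
    obtain ⟨f1, f2⟩ := key t g4 g2 g3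
    have f1' := pos_of_mul_pos_left f1 g1.le
    have f2' := pos_of_mul_pos_left f2 g1.le
    exact ⟨neg_of_mul_pos_left f1' g3.le, pos_of_mul_pos_left f2' g2.le⟩

theorem IsMultipeakon.tendsto_position (hxm : IsMultipeakon n lam a x m)
    (hlam : Function.Injective lam) (hlam0 : ∀ j, lam j ≠ 0) (ha : ∀ j, 0 < a j) (t₀ : ℝ)
    {k d : ℕ} (hn : n = k + (d + 1)) :
    Tendsto (fun t => x t (d + 1)) (𝓝[≠] t₀) (𝓝 (peakPos lam (residue lam a t₀) k)) := by
  have h := ((differentiable_peakPos hlam hlam0 ha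
    (show k < n by omega)).continuous.tendsto t₀).mono_left (nhdsWithin_le_nhds (s := {t₀}ᶜ))
  refine h.congr' ?_
  filter_upwards [eventually_isRegularTime hlam hlam0 ha t₀] with t ht
  exact (hxm.position_eq hlam hlam0 ha ht k d hn).symm

theorem IsMultipeakon.exists_tendsto_weight (hxm : IsMultipeakon n lam a x m)
    (hlam : Function.Injective lam) (hlam0 : ∀ j, lam j ≠ 0) (ha : ∀ j, 0 < a j) {t₀ : ℝ}
    {k d : ℕ} (hn : n = k + (d + 1)) (h1 : tailHankel lam (residue lam a t₀) 1 (k + 1) ≠ 0)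
    (h2 : tailHankel lam (residue lam a t₀) 1 k ≠ 0) :
    ∃ c, Tendsto (fun t => m t (d + 1)) (𝓝[≠] t₀) (𝓝 c) := by
  have hc := fun l k => ((differentiable_tailHankel (lam := lam) (a := a) l k).continuous.tendsto
    t₀).mono_left (nhdsWithin_le_nhds (s := {t₀}ᶜ))
  refine ⟨_, ((((hc 0 (k + 1)).const_mul 2).mul (hc 2 k)).div ((hc 1 (k + 1)).mul (hc 1 k))
    (mul_ne_zero h1 h2)).congr' ?_⟩
  filter_upwards [eventually_isRegularTime hlam hlam0 ha t₀, (hc 1 (k + 1)).eventually_ne h1,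
    (hc 1 k).eventually_ne h2] with t ht g1 g2
  rw [Pi.div_apply, div_eq_iff (mul_ne_zero g1 g2)]
  exact (hxm.weight_eq hlam hlam0 ha ht k d hn).symm

/-- At a collision the sum of the two weights has a limit, and the product of one weight with the
distance tends to zero. -/
theorem IsMultipeakon.tendsto_at_collision (hxm : IsMultipeakon n lam a x m)
    (hlam : Function.Injective lam) (hlam0 : ∀ j, lam j ≠ 0) (ha : ∀ j, 0 < a j) {t₀ : ℝ}
    {k d : ℕ} (hn : n = k + 1 + (d + 1))
    (h0 : tailHankel lam (residue lam a t₀) 1 (k + 1) = 0) :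
    (∃ c, Tendsto (fun t => m t (d + 1) + m t (d + 2)) (𝓝[≠] t₀) (𝓝 c)) ∧
    Tendsto (fun t => m t (d + 2) * (x t (d + 2) - x t (d + 1))) (𝓝[≠] t₀) (𝓝 0) := by
  obtain ⟨h1, h2, h3⟩ := tailHankel_one_neighbours hlam hlam0 (residue_pos ha t₀)
    (show k + 2 ≤ n by omega) h0
  have hreg := eventually_isRegularTime hlam hlam0 ha t₀
  have hδ := hasDerivAt_tailHankel_one (a := a) hlam0 t₀ k
  have hD := mul_ne_zero (two_ne_zero (α := ℝ)) (left_ne_zero_of_mul h1.ne')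
  have hQ0 := right_ne_zero_of_mul h1.ne'
  have hP0 := right_ne_zero_of_mul h2.ne
  have hd := fun l k => (differentiable_tailHankel (lam := lam) (a := a) l k)
  have hQ := ((hd 1 k).continuous.continuousAt.eventually_ne hQ0).filter_mono
    (nhdsWithin_le_nhds (s := {t₀}ᶜ))
  have hP := ((hd 1 (k + 2)).continuous.continuousAt.eventually_ne hP0).filter_mono
    (nhdsWithin_le_nhds (s := {t₀}ᶜ))
  constructor
  · let G : ℝ → ℝ := fun s =>
      2 * (tailHankel lam (residue lam a s) 0 (k + 2) * tailHankel lam (residue lam a s) 2 (k + 1) *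
        tailHankel lam (residue lam a s) 1 k +
      tailHankel lam (residue lam a s) 0 (k + 1) * tailHankel lam (residue lam a s) 2 k *
        tailHankel lam (residue lam a s) 1 (k + 2)) /
      (tailHankel lam (residue lam a s) 1 (k + 2) * tailHankel lam (residue lam a s) 1 k)
    have hG : DifferentiableAt ℝ G t₀ :=
      DifferentiableAt.fun_div ((((((hd 0 (k + 2)).fun_mul (hd 2 (k + 1))).fun_mul
        (hd 1 k)).fun_add (((hd 0 (k + 1)).fun_mul (hd 2 k)).fun_mul
          (hd 1 (k + 2)))).const_mul 2) t₀)
        (((hd 1 (k + 2)).fun_mul (hd 1 k)) t₀) (mul_ne_zero hP0 hQ0)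
    have hG0 : G t₀ = 0 := by simp only [G, h3, mul_zero, zero_div]
    refine ⟨_, (tendsto_div_of_hasDerivAt hG.hasDerivAt hδ hG0 h0 hD).congr' ?_⟩
    filter_upwards [hreg, hQ, hP] with t ht hQt hPt
    have e1 := hxm.weight_eq hlam hlam0 ha ht (k + 1) d hn
    have e2 := hxm.weight_eq hlam hlam0 ha ht k (d + 1) (by omega)
    have hδt := ht (k + 1) (by omega)
    rw [hankelOne_eq_tailHankel] at hδt
    simp only [G]
    field_simp
    linear_combination (-tailHankel lam (residue lam a t) 1 k) * e1 -
      tailHankel lam (residue lam a t) 1 (k + 2) * e2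
  · let H : ℝ → ℝ := fun s =>
      peakPos lam (residue lam a s) k - peakPos lam (residue lam a s) (k + 1)
    have hH : Differentiable ℝ H := (differentiable_peakPos hlam hlam0 ha (by omega)).sub
      (differentiable_peakPos hlam hlam0 ha (by omega))
    have hH0 : H t₀ = 0 := sub_eq_zero.2
      ((peakPos_succ_le hlam hlam0 (residue_pos ha t₀) (by omega)).2.2 h0).symm
    -- The gap is nonnegative at all times and zero at t₀, so its quotient by the simple zero
    -- Δ^1_{k+1} tends to 0, while Δ^1_{k+1} times the right weight converges.
    have hH' : deriv H t₀ = 0 := IsLocalMin.deriv_eq_zero (Eventually.of_forall fun s => by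
      rw [hH0]
      exact sub_nonneg.2 (peakPos_succ_le hlam hlam0 (residue_pos ha s) (by omega)).1)
    have hq := tendsto_div_of_hasDerivAt (hH t₀).hasDerivAt hδ hH0 h0 hD
    rw [hH', zero_div] at hq
    have hw := ((((hd 0 (k + 1)).continuous.tendsto t₀).const_mul 2).mul
      ((hd 2 k).continuous.tendsto t₀)).div ((hd 1 k).continuous.tendsto t₀) hQ0
    have := (hw.mono_left (nhdsWithin_le_nhds (s := {t₀}ᶜ))).mul hq
    rw [mul_zero] at this
    refine this.congr' ?_
    filter_upwards [hreg, hQ] with t ht hQt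
    have e2 := hxm.weight_eq hlam hlam0 ha ht k (d + 1) (by omega)
    have x1 := hxm.position_eq hlam hlam0 ha ht (k + 1) d hn
    have x2 := hxm.position_eq hlam hlam0 ha ht k (d + 1) (by omega)
    have hδt := ht (k + 1) (by omega)
    rw [hankelOne_eq_tailHankel] at hδt
    simp only [H, Pi.div_apply]
    rw [x1, x2, ← e2]
    field_simp

end

/-! ### Uniform convergence of the profile -/

/-- Uniform convergence of sums of exponentials, with pairs of terms coalescing: for `j ∈ K` the
terms `j` and `j + 1` are combined. -/
theorem tendstoUniformly_profile {n : ℕ} {x m : ℝ → ℕ → ℝ} {x₀ m₀ : ℕ → ℝ} {F : Filter ℝ}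
    (K : ℕ → Prop) [DecidablePred K] (hK0 : ¬ K 0) (hKn : ∀ j, n ≤ j → ¬ K j)
    (hK : ∀ j, K j → ¬ K (j + 1))
    (hx : ∀ j ∈ Set.Icc 1 n, Tendsto (fun t => x t j) F (𝓝 (x₀ j)))
    (hm : ∀ j ∈ Set.Icc 1 n, Tendsto (fun t => if K j then m t j + m t (j + 1) else
      if K (j - 1) then 0 else m t j) F (𝓝 (m₀ j)))
    (hmx : ∀ j ∈ Set.Icc 1 n, K j →
      Tendsto (fun t => m t (j + 1) * (x t (j + 1) - x t j)) F (𝓝 0)) :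
    TendstoUniformly (fun t => profile n (x t) (m t)) (profile n x₀ m₀) F := by
  -- The total weight of a pair is put at its left point and 0 at its right point; `R` carries the
  -- correction for the displacement.
  let W : ℝ → ℕ → ℝ := fun t j => if K j then m t j + m t (j + 1) else
    if K (j - 1) then 0 else m t j
  let e : ℝ → ℝ → ℝ := fun ξ p => Real.exp (-2 * |ξ - p|)
  let R : ℝ → ℕ → ℝ := fun t j => if K j then m t (j + 1) * (x t (j + 1) - x t j) else 0
  let B : ℝ → ℝ := fun t => (1 / 2) * ∑ j ∈ Finset.Icc 1 n,
    (|W t j - m₀ j| + |m₀ j| * (2 * |x t j - x₀ j|) + 2 * |R t j|)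
  have hB : Tendsto B F (𝓝 0) := by
    have : Tendsto B F (𝓝 ((1 / 2) * ∑ j ∈ Finset.Icc 1 n,
        (|m₀ j - m₀ j| + |m₀ j| * (2 * |x₀ j - x₀ j|) + 2 * |(0 : ℝ)|))) := by
      refine Tendsto.const_mul _ (tendsto_finsetSum _ fun j hj => ?_)
      have hj' : j ∈ Set.Icc 1 n := by simpa using hj
      refine Tendsto.add (Tendsto.add ((hm j hj').sub_const _).abs
        ((((hx j hj').sub_const _).abs.const_mul 2).const_mul _)) (Tendsto.const_mul 2 ?_)
      refine Tendsto.abs ?_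
      by_cases h : K j
      · simpa only [R, if_pos h] using hmx j hj' h
      · simp only [R, if_neg h]
        exact tendsto_const_nhds
    simpa using this
  have hsplit : ∀ t ξ, profile n (x t) (m t) ξ = (1 / 2) * ∑ j ∈ Finset.Icc 1 n,
      (W t j * e ξ (x t j) +
        if K j then m t (j + 1) * (e ξ (x t (j + 1)) - e ξ (x t j)) else 0) := by
    intro t ξ
    -- The terms at right members of pairs. Moving each one index to the left adds a telescoping sum
    -- with zero boundary terms, as neither 0 nor `n` is in `K`.
    let h : ℕ → ℝ := fun j => if K (j - 1) then m t j * e ξ (x t j) else 0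
    have hterm : ∀ j ∈ Finset.Icc 1 n, W t j * e ξ (x t j) +
        (if K j then m t (j + 1) * (e ξ (x t (j + 1)) - e ξ (x t j)) else 0) =
        m t j * e ξ (x t j) + (h (j + 1) - h j) := by
      intro j hj
      rw [Finset.mem_Icc] at hj
      simp only [W, h, Nat.add_sub_cancel]
      by_cases h1 : K j
      · have h2 : ¬ K (j - 1) := fun h2 => hK _ h2 (by rwa [Nat.sub_add_cancel hj.1])
        simp only [if_pos h1, if_neg h2]
        ring
      · by_cases h2 : K (j - 1)
        · simp only [if_neg h1, if_pos h2]
          ring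
        · simp only [if_neg h1, if_neg h2]
          ring
    rw [Finset.sum_congr rfl hterm, Finset.sum_add_distrib]
    have htel : ∑ j ∈ Finset.Icc 1 n, (h (j + 1) - h j) = 0 := by
      have : Finset.Icc 1 n = Finset.Ico 1 (n + 1) := by ext; simp
      rw [this, Finset.sum_Ico_sub _ (by omega)]
      simp [h, hK0, hKn n le_rfl]
    rw [htel, add_zero]
    rfl
  rw [Metric.tendstoUniformly_iff]
  intro ε hε
  filter_upwards [hB.eventually_lt_const hε] with t ht ξ
  refine lt_of_le_of_lt ?_ ht
  rw [dist_comm, Real.dist_eq, hsplit, profile, ← mul_sub, ← Finset.sum_sub_distrib, abs_mul,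
    abs_of_pos (by norm_num : (0 : ℝ) < 1 / 2)]
  refine mul_le_mul_of_nonneg_left ((Finset.abs_sum_le_sum_abs _ _).trans
    (Finset.sum_le_sum fun j _ => ?_)) (by norm_num)
  have he1 : |e ξ (x t j)| ≤ 1 := by
    rw [abs_of_pos (Real.exp_pos _)]
    exact Real.exp_le_one_iff.2 (by have := abs_nonneg (ξ - x t j); linarith)
  have he2 : |e ξ (x t j) - e ξ (x₀ j)| ≤ 2 * |x t j - x₀ j| := abs_exp_sub_exp_le _ _ _
  have hR : |if K j then m t (j + 1) * (e ξ (x t (j + 1)) - e ξ (x t j)) else 0| ≤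
      2 * |R t j| := by
    by_cases h : K j
    · simp only [R, if_pos h, abs_mul]
      have := mul_le_mul_of_nonneg_left (abs_exp_sub_exp_le ξ (x t (j + 1)) (x t j))
        (abs_nonneg (m t (j + 1)))
      simp only [e]
      linarith
    · simp [h]
  calc _ = |((W t j - m₀ j) * e ξ (x t j) + m₀ j * (e ξ (x t j) - e ξ (x₀ j))) +
        if K j then m t (j + 1) * (e ξ (x t (j + 1)) - e ξ (x t j)) else 0| := by
        congr 1
        simp only [e]
        ring
    _ ≤ _ := by
        refine (abs_add_le _ _).trans (add_le_add ((abs_add_le _ _).trans (add_le_add ?_ ?_)) hR)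
        · rw [abs_mul]
          exact mul_le_of_le_one_right (abs_nonneg _) he1
        · rw [abs_mul]
          exact mul_le_mul_of_nonneg_left he2 (abs_nonneg _)

end Peakon

theorem theorem6p1 (n : ℕ) (lam a : Fin n → ℝ)
    (hlam : Function.Injective lam) (hlam0 : ∀ j, lam j ≠ 0) (ha : ∀ j, 0 < a j)
    (x m : ℝ → ℕ → ℝ) (hxm : Peakon.IsMultipeakon n lam a x m)
    (t₀ : ℝ) (ht₀ : ∃ k ≤ n, Peakon.hankelOne lam a (n - k) t₀ = 0) :
    -- all times close to `t₀` are regular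
    (∀ᶠ t in 𝓝[≠] t₀, Peakon.IsRegularTime lam a t) ∧
    -- a vanishing determinant belongs to a pair `k, k + 1`, and distinct pairs are disjoint
    (∀ k ≤ n, Peakon.hankelOne lam a (n - k) t₀ = 0 →
      1 ≤ k ∧ k + 1 ≤ n ∧ Peakon.hankelOne lam a (n - (k + 1)) t₀ ≠ 0) ∧
    -- in such a pair a peakon on the left and an antipeakon on the right are interchanged
    (∀ k ≤ n, Peakon.hankelOne lam a (n - k) t₀ = 0 →
      (∀ᶠ t in 𝓝[<] t₀, 0 < m t k ∧ m t (k + 1) < 0) ∧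
      (∀ᶠ t in 𝓝[>] t₀, m t k < 0 ∧ 0 < m t (k + 1))) ∧
    ∃ x₀ m₀ : ℕ → ℝ,
      -- the positions converge
      (∀ j ∈ Set.Icc 1 n, Tendsto (fun t => x t j) (𝓝[≠] t₀) (𝓝 (x₀ j))) ∧
      -- the collisions are exactly those within the pairs above
      (∀ i ∈ Set.Icc 1 n, ∀ j ∈ Set.Icc 1 n, i < j →
        x₀ i ≤ x₀ j ∧
        (x₀ i = x₀ j ↔ j = i + 1 ∧ Peakon.hankelOne lam a (n - i) t₀ = 0)) ∧
      -- `u` converges uniformly, from both sides, to a function of the same form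
      TendstoUniformly (fun t => Peakon.profile n (x t) (m t)) (Peakon.profile n x₀ m₀)
        (𝓝[≠] t₀) := by
  have hpos := Peakon.residue_pos (lam := lam) ha t₀
  have hK : ∀ k ≤ n, Peakon.hankelOne lam a (n - k) t₀ = 0 →
      1 ≤ k ∧ k + 1 ≤ n ∧ Peakon.hankelOne lam a (n - (k + 1)) t₀ ≠ 0 := by
    intro k hk h
    rw [Peakon.hankelOne_eq_tailHankel] at h
    obtain ⟨i, hi, hin⟩ := Peakon.tailHankel_one_eq_zero hlam hlam0 hpos (by omega) h
    refine ⟨by omega, by omega, ?_⟩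
    rw [hi] at h
    have := (Peakon.tailHankel_one_neighbours hlam hlam0 hpos hin h).1
    rw [Peakon.hankelOne_eq_tailHankel, show n - (k + 1) = i by omega]
    exact right_ne_zero_of_mul this.ne'
  have hK' : ∀ k, Peakon.hankelOne lam a (n - k) t₀ = 0 → ∃ i d, k = d + 1 ∧ n = i + 1 + (d + 1) ∧
      Peakon.tailHankel lam (Peakon.residue lam a t₀) 1 (i + 1) = 0 := by
    intro k h
    have hkn : k ≤ n := by
      -- For k > n truncated subtraction gives Δ^1_0 = 1, so no bound on `k` is needed.
      by_contra! hk
      rw [show n - k = 0 by omega, Peakon.hankelOne_eq_tailHankel, Peakon.tailHankel_zero] at h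
      exact one_ne_zero h
    obtain ⟨h1, h2, -⟩ := hK k hkn h
    refine ⟨n - k - 1, k - 1, by omega, by omega, ?_⟩
    rwa [show n - k - 1 + 1 = n - k by omega, ← Peakon.hankelOne_eq_tailHankel]
  refine ⟨Peakon.eventually_isRegularTime hlam hlam0 ha t₀, hK, fun k _ h => ?_, ?_⟩
  · obtain ⟨i, d, rfl, hn, h0⟩ := hK' k h
    exact hxm.sign_change hlam hlam0 ha hn h0
  classical
  let x₀ : ℕ → ℝ := fun j => Peakon.peakPos lam (Peakon.residue lam a t₀) (n - j)
  have hW : ∀ j, ∃ c, j ∈ Set.Icc 1 n → Tendsto (fun t =>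
      if Peakon.hankelOne lam a (n - j) t₀ = 0 then m t j + m t (j + 1) else
      if Peakon.hankelOne lam a (n - (j - 1)) t₀ = 0 then 0 else m t j) (𝓝[≠] t₀) (𝓝 c) := by
    intro j
    by_cases hj : j ∈ Set.Icc 1 n
    swap
    · exact ⟨0, fun h => absurd h hj⟩
    by_cases h1 : Peakon.hankelOne lam a (n - j) t₀ = 0
    · simp only [if_pos h1]
      obtain ⟨i, d, rfl, hn, h0⟩ := hK' j h1
      obtain ⟨c, hc⟩ := (hxm.tendsto_at_collision hlam hlam0 ha hn h0).1
      exact ⟨c, fun _ => hc⟩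
    · simp only [if_neg h1]
      by_cases h2 : Peakon.hankelOne lam a (n - (j - 1)) t₀ = 0
      · simp only [if_pos h2]
        exact ⟨0, fun _ => tendsto_const_nhds⟩
      · simp only [if_neg h2]
        obtain ⟨d, rfl⟩ : ∃ d, j = d + 1 := ⟨j - 1, by have := hj.1; omega⟩
        have hjn := hj.2
        rw [Peakon.hankelOne_eq_tailHankel] at h1 h2
        rw [show n - (d + 1 - 1) = n - (d + 1) + 1 by omega] at h2
        obtain ⟨c, hc⟩ := hxm.exists_tendsto_weight hlam hlam0 ha
          (show n = (n - (d + 1)) + (d + 1) by omega) h2 h1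
        exact ⟨c, fun _ => hc⟩
  choose m₀ hm₀ using hW
  have hx : ∀ j ∈ Set.Icc 1 n, Tendsto (fun t => x t j) (𝓝[≠] t₀) (𝓝 (x₀ j)) := by
    intro j hj
    obtain ⟨d, rfl⟩ : ∃ d, j = d + 1 := ⟨j - 1, by have := hj.1; omega⟩
    exact hxm.tendsto_position hlam hlam0 ha t₀ (by have := hj.2; omega)
  have hstep : ∀ j, 1 ≤ j → j + 1 ≤ n → x₀ j ≤ x₀ (j + 1) ∧
      (x₀ j = x₀ (j + 1) ↔ Peakon.hankelOne lam a (n - j) t₀ = 0) := by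
    intro j hj hjn
    have h := Peakon.peakPos_succ_le hlam hlam0 hpos (show n - (j + 1) + 1 < n by omega)
    rw [← Peakon.hankelOne_eq_tailHankel, show n - (j + 1) + 1 = n - j by omega] at h
    exact h
  have hmono : ∀ i j, 1 ≤ i → i ≤ j → j ≤ n → x₀ i ≤ x₀ j := by
    intro i j hi hij
    induction j, hij using Nat.le_induction with
    | base => exact fun _ => le_rfl
    | succ j hij ih => exact fun hj => (ih (by omega)).trans (hstep j (by omega) hj).1
  refine ⟨x₀, m₀, hx, fun i hi j hj hij => ⟨hmono i j hi.1 hij.le hj.2, fun h => ?_, ?_⟩, ?_⟩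
  · have h1 : x₀ i = x₀ (i + 1) := le_antisymm (hstep i hi.1 (hij.trans_le hj.2)).1
      (h ▸ hmono (i + 1) j (by omega) hij hj.2)
    have h2 := (hstep i hi.1 (hij.trans_le hj.2)).2.1 h1
    refine ⟨?_, h2⟩
    -- If x₀ i = x₀ j with j ≥ i + 2, then monotonicity makes both i and i + 1 collision indices,
    -- which `hK` forbids.
    by_contra hne
    have hij2 : i + 2 ≤ j := by omega
    have hjn := hj.2
    have h3 : x₀ (i + 1) = x₀ (i + 1 + 1) := le_antisymm (hstep (i + 1) (by omega) (by omega)).1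
      (h1 ▸ h ▸ hmono (i + 2) j (by omega) hij2 hjn)
    exact (hK i hi.2 h2).2.2 ((hstep (i + 1) (by omega) (by omega)).2.1 h3)
  · rintro ⟨rfl, h⟩
    exact (hstep i hi.1 hj.2).2.2 h
  · refine Peakon.tendstoUniformly_profile
      (fun j => Peakon.hankelOne lam a (n - j) t₀ = 0) (fun h => ?_) (fun j hj h => ?_)
      (fun j h => ?_) hx (fun j hj => hm₀ j hj) (fun j _ h => ?_)
    · have := (hK 0 (Nat.zero_le n) h).1
      omega
    · obtain ⟨i, d, h1, h2, -⟩ := hK' j h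
      omega
    · obtain ⟨i, d, h1, h2, -⟩ := hK' j h
      exact (hK j (by omega) h).2.2
    · obtain ⟨i, d, rfl, hn, h0⟩ := hK' j h
      exact (hxm.tendsto_at_collision hlam hlam0 ha hn h0).2
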